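/- Let $(B,g_B)$ and $(F,g_F)$ be (finite-dimensional, smooth, boundaryless) pseudo-Riemannian manifolds and let $c,w\colon B\to(0,\infty)$ be smooth. Let $\pi\colon B\times F\to B$ and $\sigma\colon B\times F\to F$ be the projections, and equip $B\times F$ with the metric of the base conformal warped product (bcwp), $$g=c^2g_B\oplus w^2g_F=(c\circ\pi)^2\pi^*g_B+(w\circ\pi)^2\sigma^*g_F .$$ Functions on $B$ or $F$ are identified with their pull-backs to $B\times F$, and vector fields on $B$ or $F$ with their lifts to $B\times F$ (the lift of a field on one factor projects to that field on this factor and to $0$ on the other). For any pseudo-Riemannian metric, $\nabla$ denotes its Levi-Civita covariant derivative and also its gradient on functions, $R(X,Y)Z=\nabla_X\nabla_YZ-\nabla_Y\nabla_XZ-\nabla_{[X,Y]}Z$ its Riemann curvature tensor, and $H^f(X,Y)=X(Y(f))-(\nabla_XY)(f)$ its Hessian. Objects belonging to $(B,g_B)$ and $(F,g_F)$ carry the label $B$ or $F$; unlabelled ones, including $H^c$ and $H^w$, belong to $(B\times F,g)$. Put $h^w(X)=\nabla_X\nabla w$. **Theorem.** Let $X,Y,Z$ be (lifts of) smooth vector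 fields on $B$ and $V,W,U$ be (lifts of) smooth vector fields on $F$. Then 1. $$\begin{aligned}R(X,Y)Z={}&R_B(X,Y)Z-\frac{H^c(Y,Z)}{c}X+\frac{H^c(X,Z)}{c}Y+2\frac{X(c)}{c^2}g_B(Y,Z)\nabla^Bc-2\frac{Y(c)}{c^2}g_B(X,Z)\nabla^Bc\\&+\frac{g_B(X,Z)}{c}\nabla^B_Y\nabla^Bc-\frac{g_B(Y,Z)}{c}\nabla^B_X\nabla^Bc;\end{aligned}$$ 2. $R(X,V)Y=\dfrac{H^w(X,Y)}{w}V$; 3. $R(X,Y)V=0$; 4. $R(V,W)X=0$; 5. $R(V,X)W=w\,g_F(V,W)\,h^w(X)$; 6. $R(V,W)U=R_F(V,W)U+\dfrac{g_B(\nabla^Bw,\nabla^Bw)}{c^2}\bigl(g_F(V,U)W-g_F(W,U)V\bigr)$; and, moreover, $$h^w(X)=-2\frac{X(c)}{c^3}\nabla^Bw+\frac1{c^2}\Bigl(\nabla^B_X\nabla^Bw+\frac{X(c)}{c}\nabla^Bw+\frac{g_B(\nabla^Bw,\nabla^Bc)}{c}X-\frac{X(w)}{c}\nabla^Bc\Bigr).$$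 -/

import Mathlib

open scoped Manifold ContDiff Bundle Topology

noncomputable section

section PseudoRiemannian

variable {E : Type*} [NormedAddCommGroup E] [NormedSpace ℝ E]
  {H : Type*} [TopologicalSpace H] (I : ModelWithCorners ℝ E H)
  (M : Type*) [TopologicalSpace M] [ChartedSpace H M] [IsManifold I ∞ M]

/-- A pseudo-Riemannian metric on a smooth manifold: a smooth field of symmetric nondegenerate
bilinear forms on the tangent spaces. No definiteness is assumed. -/
structure PseudoRiemannianMetric where
  /-- the scalar product on the tangent space at a point -/
  val (x : M) : TangentSpace I x →L[ℝ] TangentSpace I x →L[ℝ] ℝ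
  symm (x : M) (v w : TangentSpace I x) : val x v w = val x w v
  nondegenerate (x : M) (v : TangentSpace I x) (hv : ∀ w, val x v w = 0) : v = 0
  contMDiff : ContMDiff I (I.prod 𝓘(ℝ, E →L[ℝ] E →L[ℝ] ℝ)) ∞
    (fun x ↦ Bundle.TotalSpace.mk' (E →L[ℝ] E →L[ℝ] ℝ)
      (E := fun x : M ↦ TangentSpace I x →L[ℝ] TangentSpace I x →L[ℝ] ℝ) x (val x))

variable {I M}

/-- A (globally defined) smooth vector field. -/
def IsSmoothVectorField (X : Π x : M, TangentSpace I x) : Prop :=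
  ContMDiff I I.tangent ∞ (fun x ↦ (⟨x, X x⟩ : TangentBundle I M))

/-- The derivative `X(f)` of the function `f` along the vector field `X`. -/
def dirDeriv (X : Π x : M, TangentSpace I x) (f : M → ℝ) : M → ℝ :=
  fun x ↦ mvfderiv I f x (X x)

namespace PseudoRiemannianMetric

variable (g : PseudoRiemannianMetric I M)

/-- The function `g(X, Y)` for two vector fields `X`, `Y`. -/
def pair (X Y : Π x : M, TangentSpace I x) : M → ℝ := fun x ↦ g.val x (X x) (Y x)

theorem mdifferentiableAt_pair {X Y : Π x : M, TangentSpace I x} {x : M}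
    (hX : MDifferentiableAt I I.tangent (fun y ↦ (⟨y, X y⟩ : TangentBundle I M)) x)
    (hY : MDifferentiableAt I I.tangent (fun y ↦ (⟨y, Y y⟩ : TangentBundle I M)) x) :
    MDifferentiableAt I 𝓘(ℝ, ℝ) (g.pair X Y) x := by
  have h := (g.contMDiff x).mdifferentiableAt (by simp)
  have := MDifferentiableAt.clm_bundle_apply₂ (F₁ := E) (F₂ := E) (F₃ := ℝ)
    (E₃ := Bundle.Trivial M ℝ) h hX hY
  exact (mdifferentiableAt_section (IB := I) (F := ℝ) (E := Bundle.Trivial M ℝ) _).1 this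

/-- The right hand side of the Koszul formula for `2 g(∇_X Y, Z)`. -/
def koszul (X Y Z : Π x : M, TangentSpace I x) (x : M) : ℝ :=
  dirDeriv X (g.pair Y Z) x + dirDeriv Y (g.pair X Z) x - dirDeriv Z (g.pair X Y) x
    + g.pair (VectorField.mlieBracket I X Y) Z x
    - g.pair (VectorField.mlieBracket I X Z) Y x
    - g.pair (VectorField.mlieBracket I Y Z) X x

variable [FiniteDimensional ℝ E]

theorem tensorialAt_koszul {X Y : Π x : M, TangentSpace I x} {x : M}
    (hX : MDifferentiableAt I I.tangent (fun y ↦ (⟨y, X y⟩ : TangentBundle I M)) x)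
    (hY : MDifferentiableAt I I.tangent (fun y ↦ (⟨y, Y y⟩ : TangentBundle I M)) x) :
    TensorialAt I E (fun Z ↦ g.koszul X Y Z x) x := by
  have : CompleteSpace E := FiniteDimensional.complete ℝ E
  constructor
  · intro f Z hf hZ
    have e1 : g.pair Y (f • Z) = f * g.pair Y Z := by ext y; simp [pair]
    have e2 : g.pair X (f • Z) = f * g.pair X Z := by ext y; simp [pair]
    simp only [koszul, dirDeriv, e1, e2, mvfderiv_mul hf (g.mdifferentiableAt_pair hY hZ),
      mvfderiv_mul hf (g.mdifferentiableAt_pair hX hZ)]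
    simp only [pair, VectorField.mlieBracket_smul_right hf hZ]
    simp [g.symm x (Z x)]
    ring
  · intro Z Z' hZ hZ'
    have e1 : g.pair Y (Z + Z') = g.pair Y Z + g.pair Y Z' := by ext y; simp [pair]
    have e2 : g.pair X (Z + Z') = g.pair X Z + g.pair X Z' := by ext y; simp [pair]
    simp only [koszul, dirDeriv, e1, e2,
      mvfderiv_add (g.mdifferentiableAt_pair hY hZ) (g.mdifferentiableAt_pair hY hZ'),
      mvfderiv_add (g.mdifferentiableAt_pair hX hZ) (g.mdifferentiableAt_pair hX hZ')]
    simp only [pair, VectorField.mlieBracket_add_right hZ hZ']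
    simp
    ring

/-- The musical isomorphism: the vector `v` with `g(v, w) = α(w)` for all `w`. -/
def flatEquiv (x : M) : TangentSpace I x ≃ₗ[ℝ] (TangentSpace I x →L[ℝ] ℝ) :=
  haveI : FiniteDimensional ℝ (TangentSpace I x) := inferInstanceAs (FiniteDimensional ℝ E)
  haveI : T2Space (TangentSpace I x) := inferInstanceAs (T2Space E)
  LinearEquiv.ofInjectiveOfFinrankEq (g.val x).toLinearMap
    ((injective_iff_map_eq_zero _).2 fun v hv ↦ g.nondegenerate x v fun w ↦ by
      simpa using congrArg (fun α : TangentSpace I x →L[ℝ] ℝ ↦ α w) hv)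
    (((LinearMap.toContinuousLinearMap :
      (TangentSpace I x →ₗ[ℝ] ℝ) ≃ₗ[ℝ] (TangentSpace I x →L[ℝ] ℝ)).finrank_eq.symm.trans
        Subspace.dual_finrank_eq).symm)

theorem val_flatEquiv_symm (x : M) (α : TangentSpace I x →L[ℝ] ℝ) (w : TangentSpace I x) :
    g.val x ((g.flatEquiv x).symm α) w = α w :=
  congrArg (fun β : TangentSpace I x →L[ℝ] ℝ ↦ β w) ((g.flatEquiv x).apply_symm_apply α)

/-- The gradient of a function: `g(grad f, v) = df(v)`. -/
def grad (f : M → ℝ) (x : M) : TangentSpace I x := (g.flatEquiv x).symm (mvfderiv I f x)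

open Classical in
/-- The Levi-Civita covariant derivative `∇_X Y`, i.e. the vector field determined by the Koszul
formula (see `two_mul_val_cov`). The value is `0` by convention at the points where `X` or `Y` is
not differentiable. -/
def cov (X Y : Π x : M, TangentSpace I x) (x : M) : TangentSpace I x :=
  if h : MDifferentiableAt I I.tangent (fun y ↦ (⟨y, X y⟩ : TangentBundle I M)) x ∧
      MDifferentiableAt I I.tangent (fun y ↦ (⟨y, Y y⟩ : TangentBundle I M)) x then
    (g.flatEquiv x).symm
      ((2⁻¹ : ℝ) • TensorialAt.mkHom (fun Z ↦ g.koszul X Y Z x) x (g.tensorialAt_koszul h.1 h.2))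
  else 0

/-- The Koszul formula. -/
theorem two_mul_val_cov {X Y Z : Π x : M, TangentSpace I x} {x : M}
    (hX : MDifferentiableAt I I.tangent (fun y ↦ (⟨y, X y⟩ : TangentBundle I M)) x)
    (hY : MDifferentiableAt I I.tangent (fun y ↦ (⟨y, Y y⟩ : TangentBundle I M)) x)
    (hZ : MDifferentiableAt I I.tangent (fun y ↦ (⟨y, Z y⟩ : TangentBundle I M)) x) :
    2 * g.val x (g.cov X Y x) (Z x) = g.koszul X Y Z x := by
  have h := TensorialAt.mkHom_apply (g.tensorialAt_koszul hX hY) hZ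
  rw [cov, dif_pos ⟨hX, hY⟩, val_flatEquiv_symm, ← h]
  simp

/-- The Riemann curvature `R(X, Y)Z = ∇_X ∇_Y Z - ∇_Y ∇_X Z - ∇_[X, Y] Z`. -/
def curvature (X Y Z : Π x : M, TangentSpace I x) (x : M) : TangentSpace I x :=
  g.cov X (g.cov Y Z) x - g.cov Y (g.cov X Z) x - g.cov (VectorField.mlieBracket I X Y) Z x

/-- The Hessian `H^f(X, Y) = X(Y(f)) - (∇_X Y)(f)`. -/
def hessian (f : M → ℝ) (X Y : Π x : M, TangentSpace I x) (x : M) : ℝ :=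
  dirDeriv X (dirDeriv Y f) x - dirDeriv (g.cov X Y) f x

end PseudoRiemannianMetric
end PseudoRiemannian

section Product

variable {EB : Type*} [NormedAddCommGroup EB] [NormedSpace ℝ EB]
  {HB : Type*} [TopologicalSpace HB] {IB : ModelWithCorners ℝ EB HB}
  {B : Type*} [TopologicalSpace B] [ChartedSpace HB B]
  {EF : Type*} [NormedAddCommGroup EF] [NormedSpace ℝ EF]
  {HF : Type*} [TopologicalSpace HF] {IF : ModelWithCorners ℝ EF HF}
  {F : Type*} [TopologicalSpace F] [ChartedSpace HF F]

/-- The lift to `B × F` of a vector field on `B`: under the identification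
`T_(p, q)(B × F) = T_p B × T_q F` its value at `(p, q)` is `(X_p, 0)`, i.e. the vector which
projects to `X_p` and to `0` (see `mfderiv_fst_liftBase`, `mfderiv_snd_liftBase`). -/
def liftBase (X : Π p : B, TangentSpace IB p) (x : B × F) : TangentSpace (IB.prod IF) x :=
  ((X x.1, 0) : TangentSpace IB x.1 × TangentSpace IF x.2)

/-- The lift to `B × F` of a vector field on `F`, with value `(0, V_q)` at `(p, q)`. -/
def liftFiber (V : Π q : F, TangentSpace IF q) (x : B × F) : TangentSpace (IB.prod IF) x :=
  ((0, V x.2) : TangentSpace IB x.1 × TangentSpace IF x.2)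

theorem mfderiv_fst_liftBase (X : Π p : B, TangentSpace IB p) (x : B × F) :
    mfderiv (IB.prod IF) IB Prod.fst x (liftBase (IF := IF) X x) = X x.1 := by
  rw [mfderiv_fst]; rfl

theorem mfderiv_snd_liftBase (X : Π p : B, TangentSpace IB p) (x : B × F) :
    mfderiv (IB.prod IF) IF Prod.snd x (liftBase (IF := IF) X x) = 0 := by
  rw [mfderiv_snd]; rfl

theorem mfderiv_fst_liftFiber (V : Π q : F, TangentSpace IF q) (x : B × F) :
    mfderiv (IB.prod IF) IB Prod.fst x (liftFiber (IB := IB) V x) = 0 := by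
  rw [mfderiv_fst]; rfl

theorem mfderiv_snd_liftFiber (V : Π q : F, TangentSpace IF q) (x : B × F) :
    mfderiv (IB.prod IF) IF Prod.snd x (liftFiber (IB := IB) V x) = V x.2 := by
  rw [mfderiv_snd]; rfl

end Product

section Pullback

variable {E : Type*} [NormedAddCommGroup E] [NormedSpace ℝ E]
  {H : Type*} [TopologicalSpace H] {I : ModelWithCorners ℝ E H}
  {M : Type*} [TopologicalSpace M] [ChartedSpace H M]
  {E' : Type*} [NormedAddCommGroup E'] [NormedSpace ℝ E']
  {H' : Type*} [TopologicalSpace H'] {I' : ModelWithCorners ℝ E' H'}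
  {N : Type*} [TopologicalSpace N] [ChartedSpace H' N]

/-- The bilinear form `a² f^* b` at the point `x`, for a function `a` and a map `f`. -/
def scaledPullback (b : Π y : N, TangentSpace I' y →L[ℝ] TangentSpace I' y →L[ℝ] ℝ)
    (a : M → ℝ) (f : M → N) (x : M) :
    TangentSpace I x →L[ℝ] TangentSpace I x →L[ℝ] ℝ :=
  (a x) ^ 2 • ((mfderiv I I' f x).precomp ℝ ∘L (b (f x) ∘L mfderiv I I' f x))

theorem scaledPullback_apply (b : Π y : N, TangentSpace I' y →L[ℝ] TangentSpace I' y →L[ℝ] ℝ)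
    (a : M → ℝ) (f : M → N) (x : M) (u v : TangentSpace I x) :
    scaledPullback b a f x u v =
      (a x) ^ 2 * b (f x) (mfderiv I I' f x u) (mfderiv I I' f x v) := rfl

theorem contMDiff_scaledPullback [IsManifold I ∞ M] [IsManifold I' ∞ N]
    (g : PseudoRiemannianMetric I' N) {a : M → ℝ}
    (ha : ContMDiff I 𝓘(ℝ, ℝ) ∞ a) {f : M → N} (hf : ContMDiff I I' ∞ f) :
    ContMDiff I (I.prod 𝓘(ℝ, E →L[ℝ] E →L[ℝ] ℝ)) ∞
    (fun x ↦ Bundle.TotalSpace.mk' (E →L[ℝ] E →L[ℝ] ℝ)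
      (E := fun x : M ↦ TangentSpace I x →L[ℝ] TangentSpace I x →L[ℝ] ℝ) x
      (scaledPullback (I := I) g.val a f x)) := by
  intro x₀
  have h1 := (contMDiffAt_hom_bundle _).1 (g.contMDiff.contMDiffAt (x := f x₀))
  have h2 := (h1.2.comp x₀ hf.contMDiffAt)
  have h3 := (hf.contMDiffAt (x := x₀)).mfderiv_const (m := ∞) (by simp)
  refine (contMDiffAt_hom_bundle _).2 ⟨contMDiffAt_id, ?_⟩
  have h4 := (ha.contMDiffAt (x := x₀)).pow 2 |>.smul
    ((h3.clm_precomp (F₃ := ℝ)).clm_comp (h2.clm_comp h3))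
  refine h4.congr_of_eventuallyEq ?_
  have A : ∀ᶠ x in 𝓝 x₀, x ∈ (trivializationAt E (TangentSpace I) x₀).baseSet :=
    (trivializationAt E (TangentSpace I) x₀).open_baseSet.mem_nhds
      (FiberBundle.mem_baseSet_trivializationAt' x₀)
  have A' : ∀ᶠ x in 𝓝 x₀, f x ∈ (trivializationAt E' (TangentSpace I') (f x₀)).baseSet :=
    hf.continuous.continuousAt.eventually <|
    (trivializationAt E' (TangentSpace I') (f x₀)).open_baseSet.mem_nhds
      (FiberBundle.mem_baseSet_trivializationAt' (f x₀))
  filter_upwards [A, A'] with x hx hx'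
  ext u v
  rw [inCoordinates_apply_eq₂ hx hx (Set.mem_univ _)]
  set A := ContinuousLinearMap.inCoordinates E (TangentSpace I) E' (TangentSpace I') x₀ x
    (f x₀) (f x) (mfderiv I I' f x) with hA
  have key : ∀ u : E, (trivializationAt E' (TangentSpace I') (f x₀)).symm (f x) (A u) =
      mfderiv I I' f x ((trivializationAt E (TangentSpace I) x₀).symm x u) := by
    intro u
    rw [hA, ContinuousLinearMap.inCoordinates_eq hx hx']
    exact ((trivializationAt E' (TangentSpace I') (f x₀)).continuousLinearEquivAt ℝ _ hx'
      ).symm_apply_apply _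
  change _ = (a x) ^ 2 * (ContinuousLinearMap.inCoordinates E' (TangentSpace I') (E' →L[ℝ] ℝ)
    (fun b ↦ TangentSpace I' b →L[ℝ] Bundle.Trivial N ℝ b) (f x₀) (f x) (f x₀) (f x)
    (g.val (f x)) (A u) (A v))
  rw [inCoordinates_apply_eq₂ hx' hx' (Set.mem_univ _), key, key]
  simp [scaledPullback]

end Pullback

section BaseConformalWarpedProduct

variable {EB : Type*} [NormedAddCommGroup EB] [NormedSpace ℝ EB]
  {HB : Type*} [TopologicalSpace HB] {IB : ModelWithCorners ℝ EB HB}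
  {B : Type*} [TopologicalSpace B] [ChartedSpace HB B] [IsManifold IB ∞ B]
  {EF : Type*} [NormedAddCommGroup EF] [NormedSpace ℝ EF]
  {HF : Type*} [TopologicalSpace HF] {IF : ModelWithCorners ℝ EF HF}
  {F : Type*} [TopologicalSpace F] [ChartedSpace HF F] [IsManifold IF ∞ F]

/-- The metric `(c ∘ π)² π^* g_B + (w ∘ π)² σ^* g_F` of the base conformal warped product on
`B × F`, where `π` and `σ` are the projections to `B` and `F`. -/
def bcwpMetric (gB : PseudoRiemannianMetric IB B) (gF : PseudoRiemannianMetric IF F)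
    (c w : B → ℝ) (hc : ContMDiff IB 𝓘(ℝ, ℝ) ∞ c) (hw : ContMDiff IB 𝓘(ℝ, ℝ) ∞ w)
    (hc0 : ∀ p, 0 < c p) (hw0 : ∀ p, 0 < w p) :
    PseudoRiemannianMetric (IB.prod IF) (B × F) where
  val x := scaledPullback (I := IB.prod IF) gB.val (c ∘ Prod.fst) Prod.fst x +
    scaledPullback (I := IB.prod IF) gF.val (w ∘ Prod.fst) Prod.snd x
  symm x u v := by
    change scaledPullback gB.val (c ∘ Prod.fst) Prod.fst x u v +
      scaledPullback gF.val (w ∘ Prod.fst) Prod.snd x u v =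
      scaledPullback gB.val (c ∘ Prod.fst) Prod.fst x v u +
      scaledPullback gF.val (w ∘ Prod.fst) Prod.snd x v u
    simp only [scaledPullback_apply]
    rw [gB.symm, gF.symm]
  nondegenerate x v hv := by
    have key : ∀ (z1 : TangentSpace IB x.1) (z2 : TangentSpace IF x.2),
        (c x.1) ^ 2 * gB.val x.1 v.1 z1 + (w x.1) ^ 2 * gF.val x.2 v.2 z2 = 0 := by
      intro z1 z2
      obtain ⟨z, rfl, rfl⟩ : ∃ z : TangentSpace (IB.prod IF) x, z.1 = z1 ∧ z.2 = z2 :=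
        ⟨((z1, z2) : TangentSpace IB x.1 × TangentSpace IF x.2), rfl, rfl⟩
      have h : scaledPullback gB.val (c ∘ Prod.fst) Prod.fst x v z +
        scaledPullback gF.val (w ∘ Prod.fst) Prod.snd x v z = 0 := hv z
      rw [scaledPullback_apply, scaledPullback_apply, mfderiv_fst, mfderiv_snd] at h
      exact h
    have h1 : v.1 = 0 := gB.nondegenerate x.1 v.1 fun z ↦ by
      simpa [(hc0 x.1).ne'] using key z 0
    have h2 : v.2 = 0 := gF.nondegenerate x.2 v.2 fun z ↦ by
      simpa [(hw0 x.1).ne'] using key 0 z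
    exact Prod.ext h1 h2
  contMDiff := by
    have h1 := contMDiff_scaledPullback gB (I := IB.prod IF) (hc.comp contMDiff_fst)
      (contMDiff_fst (M := B) (N := F) (J := IF))
    have h2 := contMDiff_scaledPullback gF (I := IB.prod IF)
      (hw.comp (contMDiff_fst (N := F) (J := IF))) (contMDiff_snd (M := B) (N := F) (I := IB))
    exact h1.add_section h2

end BaseConformalWarpedProduct
end

open scoped Manifold ContDiff Bundle Topology

noncomputable section

/-! ### Lie brackets as commutators of derivations, and their naturality under smooth maps. -/

section Derivation

variable {E : Type*} [NormedAddCommGroup E] [NormedSpace ℝ E]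
  {H : Type*} [TopologicalSpace H] {I : ModelWithCorners ℝ E H}
  {M : Type*} [TopologicalSpace M] [ChartedSpace H M]
  {G : Type*} [NormedAddCommGroup G] [NormedSpace ℝ G]

/-! The Koszul formula determines `∇`, and on a product it need only be tested against lifts, since
these span every tangent space (`cov_eq_of_koszul_lift`). Lifts from one factor bracket to the lift
of the bracket, lifts from different factors commute, and functions on one factor are constant along
the other. Hence most Koszul terms vanish, and what survives is, with `∇w = c⁻² ∇^B w`: `∇_X Y =
∇^B_X Y + (X(c)/c) Y + (Y(c)/c) X - (g_B(X,Y)/c) ∇^B c` (this is `conformalCov`), `∇_X V = ∇_V X =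
(X(w)/w) V`, and `∇_V W = ∇^F_V W - w g_F(V,W) ∇w`.

All the curvature formulas follow from these by the Leibniz rule. On base fields `R` is the lifted
curvature of `c² g_B` (`conformalCov_curvature`); leaving `(∇_Y Z)(c)` unexpanded there completes
`Y(Z(c))` to the Hessian `H^c(Y,Z)`. In the mixed cases the coefficients `X(w)/w` are functions on
the base, so fibre fields do not differentiate them. On fibre fields the only correction to `R_F`
comes from `∇_V ∇w = (g_B(∇^B w, ∇^B w) / (c² w)) V`, because `∇w` is itself a base lift.

Two facts support this: brackets of related fields are related (`mfderiv_mlieBracket_of_related`),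
which gives the brackets of lifts through the two projections; and `∇_X Y` and gradients are smooth
(`contMDiffAt_of_pair`), so that they may be differentiated again. -/

/-- Being `C^∞` at a point is not an open condition, since the neighbourhood may shrink with the
order; each finite order is. Order one is enough for differentiability nearby. -/
theorem eventually_contMDiffAt_one [IsManifold I ∞ M] {E' : Type*} [NormedAddCommGroup E']
    [NormedSpace ℝ E'] {H' : Type*} [TopologicalSpace H'] {I' : ModelWithCorners ℝ E' H'}
    {N : Type*} [TopologicalSpace N] [ChartedSpace H' N] [IsManifold I' ∞ N] {f : M → N} {x : M}
    (hf : ContMDiffAt I I' ∞ f x) : ∀ᶠ y in 𝓝 x, ContMDiffAt I I' 1 f y :=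
  (contMDiffAt_iff_contMDiffAt_nhds (by simp)).1 (hf.of_le (by simp))

/-- The tangent map of `f` applied to the section `V` is a smooth curve of tangent vectors of `G`;
the second projection of the trivial bundle `TG` extracts the value. -/
theorem ContMDiffAt.mvfderiv_apply [IsManifold I ∞ M] {f : M → G}
    {V : Π x : M, TangentSpace I x} {x : M}
    (hf : ContMDiffAt I 𝓘(ℝ, G) ∞ f x)
    (hV : ContMDiffAt I I.tangent ∞ (fun y ↦ (⟨y, V y⟩ : TangentBundle I M)) x) :
    ContMDiffAt I 𝓘(ℝ, G) ∞ (fun y ↦ mvfderiv I f y (V y)) x := by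
  have h1 := hf.mfderiv_const (m := ∞) (by simp)
  have h2 := ContMDiffAt.clm_apply_of_inCoordinates h1 hV hf
  exact (contMDiff_snd_tangentBundle_modelSpace G 𝓘(ℝ, G)).contMDiffAt.comp x h2

variable [I.Boundaryless] [CompleteSpace E] [IsManifold I ∞ M]

omit [CompleteSpace E] in
-- Chain rule: pulling `V` back applies the inverse of the derivative of the inverse chart, which
-- that derivative then undoes. This carries directional derivatives between the chart and the
-- manifold.
theorem fderiv_comp_extChartAt_symm_mpullback {x : M} {f : M → G} {u : E}
    (hu : u ∈ (extChartAt I x).target)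
    (hf : MDifferentiableAt I 𝓘(ℝ, G) f ((extChartAt I x).symm u))
    (V : Π y : M, TangentSpace I y) :
    fderiv ℝ (f ∘ (extChartAt I x).symm) u
      (VectorField.mpullback 𝓘(ℝ, E) I (extChartAt I x).symm V u) =
    mvfderiv I f ((extChartAt I x).symm u) (V ((extChartAt I x).symm u)) := by
  have h1 : MDifferentiableAt 𝓘(ℝ, E) I (extChartAt I x).symm u := by
    have := mdifferentiableWithinAt_extChartAt_symm (I := I) hu
    rwa [I.range_eq_univ, mdifferentiableWithinAt_univ] at this
  have h2 : (mfderiv 𝓘(ℝ, E) I (extChartAt I x).symm u).IsInvertible := by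
    have := isInvertible_mfderivWithin_extChartAt_symm (I := I) hu
    rwa [I.range_eq_univ, mfderivWithin_univ] at this
  have h3 := mfderiv_comp_apply u hf h1
    (VectorField.mpullback 𝓘(ℝ, E) I (extChartAt I x).symm V u)
  rw [VectorField.mpullback_apply, h2.self_apply_inverse, mfderiv_eq_fderiv] at h3
  exact h3

/-- Differentiation along the Lie bracket of two vector fields is the commutator of the
differentiations along them. -/
theorem mvfderiv_mlieBracket {f : M → G} {V W : Π x : M, TangentSpace I x} {x : M}
    (hf : ContMDiffAt I 𝓘(ℝ, G) ∞ f x)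
    (hV : ContMDiffAt I I.tangent ∞ (fun y ↦ (⟨y, V y⟩ : TangentBundle I M)) x)
    (hW : ContMDiffAt I I.tangent ∞ (fun y ↦ (⟨y, W y⟩ : TangentBundle I M)) x) :
    mvfderiv I f x (VectorField.mlieBracket I V W x) =
      mvfderiv I (fun y ↦ mvfderiv I f y (W y)) x (V x) -
        mvfderiv I (fun y ↦ mvfderiv I f y (V y)) x (W x) := by
  have : IsManifold I 2 M := inferInstance
  set φ := extChartAt I x with hφ
  have hx : φ.symm (φ x) = x := extChartAt_to_inv x
  have hmem : φ x ∈ φ.target := mem_extChartAt_target x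
  let V' : E → E := VectorField.mpullback 𝓘(ℝ, E) I φ.symm V
  let W' : E → E := VectorField.mpullback 𝓘(ℝ, E) I φ.symm W
  -- The manifold bracket is by definition the chart bracket pulled back; without boundary the
  -- `within` versions reduce to the plain ones.
  have hbr : VectorField.mlieBracket I V W x =
      (mfderiv I 𝓘(ℝ, E) φ x).inverse (VectorField.lieBracket (E := E) ℝ V' W' (φ x)) := by
    rw [← VectorField.mlieBracketWithin_univ, VectorField.mlieBracketWithin_apply]
    rw [I.range_eq_univ, VectorField.mpullbackWithin_univ, VectorField.mpullbackWithin_univ,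
      Set.preimage_univ, Set.univ_inter]
    exact congrArg (mfderiv I 𝓘(ℝ, E) φ x).inverse
      (congrFun (VectorField.lieBracketWithin_univ (𝕜 := ℝ) (V := V') (W := W')) (φ x))
  have diff : ∀ {V : Π x : M, TangentSpace I x},
      ContMDiffAt I I.tangent ∞ (fun y ↦ (⟨y, V y⟩ : TangentBundle I M)) x →
      DifferentiableAt ℝ (VectorField.mpullback 𝓘(ℝ, E) I φ.symm V : E → E) (φ x) := by
    intro V hV
    have h := MDifferentiableWithinAt.differentiableWithinAt_mpullbackWithin_vectorField
      (hV.mdifferentiableAt (by simp)).mdifferentiableWithinAt (s := Set.univ)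
    rw [I.range_eq_univ, VectorField.mpullbackWithin_univ, Set.preimage_univ, Set.univ_inter] at h
    exact differentiableWithinAt_univ.1 h
  have hfc : ContDiffAt ℝ ∞ (f ∘ φ.symm) (φ x) := by
    rw [← contMDiffAt_iff_contDiffAt]
    refine ContMDiffAt.comp (I' := I) (φ x) (by rwa [hx]) ?_
    have := contMDiffWithinAt_extChartAt_symm_range (I := I) (n := ∞) x hmem
    rwa [I.range_eq_univ, contMDiffWithinAt_univ] at this
  -- The equality must hold near `φ x`, not only at it, because both sides are differentiated once
  -- more.
  have key : ∀ {h : M → G} (V : Π x : M, TangentSpace I x), ContMDiffAt I 𝓘(ℝ, G) ∞ h x →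
      (fun u ↦ fderiv ℝ (h ∘ φ.symm) u (VectorField.mpullback 𝓘(ℝ, E) I φ.symm V u)) =ᶠ[𝓝 (φ x)]
      (fun y ↦ mvfderiv I h y (V y)) ∘ φ.symm := by
    intro h V hh
    have e1 : ∀ᶠ y in 𝓝 x, ContMDiffAt I 𝓘(ℝ, G) 1 h y :=
      eventually_contMDiffAt_one hh
    have e2 : ∀ᶠ u in 𝓝 (φ x), ContMDiffAt I 𝓘(ℝ, G) 1 h (φ.symm u) := by
      refine (continuousAt_extChartAt_symm (I := I) x).eventually ?_
      rwa [← hφ, hx]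
    filter_upwards [e2, extChartAt_target_mem_nhds (I := I) x] with u hu hu'
    exact fderiv_comp_extChartAt_symm_mpullback hu' (hu.mdifferentiableAt (by simp)) V
  -- The identity in the model space, where symmetry of the second derivative enters.
  have main := VectorField.fderiv_apply_lieBracket hfc (by simpa using WithTop.coe_le_coe.2 (le_top : (2 : ℕ∞) ≤ ⊤)) (diff hW) (diff hV)
  rw [(key W hf).fderiv_eq, (key V hf).fderiv_eq] at main
  have e1 := (key V (hf.mvfderiv_apply hW)).self_of_nhds
  have e2 := (key W (hf.mvfderiv_apply hV)).self_of_nhds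
  rw [Function.comp_apply, hx] at e1 e2
  refine Eq.trans ?_ (main.trans (congrArg₂ (· - ·) e1 e2))
  rw [hbr]
  have hinv := isInvertible_mfderiv_extChartAt (I := I) (mem_extChartAt_source (I := I) x)
  have e : f =ᶠ[𝓝 x] (f ∘ φ.symm) ∘ φ := by
    filter_upwards [extChartAt_source_mem_nhds (I := I) x] with y hy
    simp [φ.left_inv hy]
  have h4 := mfderiv_comp_apply (I' := 𝓘(ℝ, E)) x
    (g := f ∘ φ.symm) (f := φ) (hfc.differentiableAt (by simp)).mdifferentiableAt
    (mdifferentiableAt_extChartAt (mem_chart_source H x))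
    ((mfderiv I 𝓘(ℝ, E) φ x).inverse (VectorField.lieBracket (E := E) ℝ V' W' (φ x)))
  rw [← e.mfderiv_eq, mfderiv_eq_fderiv] at h4
  exact h4.trans (congrArg (fderiv ℝ (f ∘ φ.symm) (φ x)) (hinv.self_apply_inverse _))

variable {E' : Type*} [NormedAddCommGroup E'] [NormedSpace ℝ E'] [CompleteSpace E']
  {H' : Type*} [TopologicalSpace H'] {I' : ModelWithCorners ℝ E' H'} [I'.Boundaryless]
  {N : Type*} [TopologicalSpace N] [ChartedSpace H' N] [IsManifold I' ∞ N]

/-- Lie brackets of related vector fields are related. -/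
theorem mfderiv_mlieBracket_of_related {f : M → N} (hf : ContMDiff I I' ∞ f)
    {V W : Π x : M, TangentSpace I x} {V' W' : Π y : N, TangentSpace I' y}
    {x : M} (hV : ContMDiffAt I I.tangent ∞ (fun y ↦ (⟨y, V y⟩ : TangentBundle I M)) x)
    (hW : ContMDiffAt I I.tangent ∞ (fun y ↦ (⟨y, W y⟩ : TangentBundle I M)) x)
    (hV' : ContMDiffAt I' I'.tangent ∞ (fun y ↦ (⟨y, V' y⟩ : TangentBundle I' N)) (f x))
    (hW' : ContMDiffAt I' I'.tangent ∞ (fun y ↦ (⟨y, W' y⟩ : TangentBundle I' N)) (f x))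
    (hVV' : ∀ y, mfderiv I I' f y (V y) = V' (f y))
    (hWW' : ∀ y, mfderiv I I' f y (W y) = W' (f y)) :
    mfderiv I I' f x (VectorField.mlieBracket I V W x) = VectorField.mlieBracket I' V' W' (f x) := by
  -- The chart at `f x` serves as an `E'`-valued test function: its derivative there is injective,
  -- so it suffices to compare both sides after applying it.
  set φ := extChartAt I' (f x) with hφ
  have hφs : ContMDiffAt I' 𝓘(ℝ, E') ∞ φ (f x) := contMDiffAt_extChartAt
  have hfm : ∀ y, MDifferentiableAt I I' f y := fun y ↦ (hf y).mdifferentiableAt (by simp)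
  have hinv := isInvertible_mfderiv_extChartAt (I := I') (mem_extChartAt_source (I := I') (f x))
  have comp : ∀ {h : N → E'} {U : Π x : M, TangentSpace I x} {U' : Π y : N, TangentSpace I' y}
      (_ : ∀ x, mfderiv I I' f x (U x) = U' (f x)) {y : M}
      (_ : MDifferentiableAt I' 𝓘(ℝ, E') h (f y)),
      mvfderiv I (h ∘ f) y (U y) = mvfderiv I' h (f y) (U' (f y)) := by
    intro h U U' hU y hh
    have := mfderiv_comp_apply y hh (hfm y) (U y)
    rw [hU] at this
    exact this
  -- Relatedness turns derivatives of `φ ∘ f` along `U` into derivatives of `φ` along `U'`, so both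
  -- commutators match.
  have ev : ∀ {U : Π x : M, TangentSpace I x} {U' : Π y : N, TangentSpace I' y}
      (_ : ∀ x, mfderiv I I' f x (U x) = U' (f x)),
      (fun y ↦ mvfderiv I (φ ∘ f) y (U y)) =ᶠ[𝓝 x] (fun z ↦ mvfderiv I' φ z (U' z)) ∘ f := by
    intro U U' hU
    have : ∀ᶠ z in 𝓝 (f x), ContMDiffAt I' 𝓘(ℝ, E') 1 φ z :=
      eventually_contMDiffAt_one hφs
    filter_upwards [hf.continuous.continuousAt.eventually this] with y hy
    exact comp hU (hy.mdifferentiableAt (by simp))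
  have dd : ∀ {h h' : M → E'} (_ : h =ᶠ[𝓝 x] h') (v : TangentSpace I x),
      mvfderiv I h x v = mvfderiv I h' x v := by
    intro h h' hh v
    have := congrArg (fun L : E →L[ℝ] E' ↦ L v) (hh.mfderiv_eq (I := I) (I' := 𝓘(ℝ, E')))
    exact this
  have h1 := mvfderiv_mlieBracket (hφs.comp x (hf x)) hV hW
  rw [dd (ev hVV'), dd (ev hWW'),
    comp hVV' ((hφs.mvfderiv_apply hW').mdifferentiableAt (by simp)),
    comp hWW' ((hφs.mvfderiv_apply hV').mdifferentiableAt (by simp)),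
    ← mvfderiv_mlieBracket hφs hV' hW'] at h1
  have h2 := mfderiv_comp_apply x (hφs.mdifferentiableAt (by simp)) (hfm x)
    (VectorField.mlieBracket I V W x)
  exact hinv.injective (h2.symm.trans h1)

theorem dirDeriv_mlieBracket {f : M → ℝ} {V W : Π x : M, TangentSpace I x}
    (hf : ContMDiff I 𝓘(ℝ, ℝ) ∞ f) (hV : IsSmoothVectorField V) (hW : IsSmoothVectorField W)
    (x : M) :
    dirDeriv (VectorField.mlieBracket I V W) f x =
      dirDeriv V (dirDeriv W f) x - dirDeriv W (dirDeriv V f) x :=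
  mvfderiv_mlieBracket (hf x) (hV x) (hW x)

end Derivation

/-! ### Local smooth fields with a prescribed value. -/

section Extension

variable {E : Type*} [NormedAddCommGroup E] [NormedSpace ℝ E]
  {H : Type*} [TopologicalSpace H] {I : ModelWithCorners ℝ E H}
  {M : Type*} [TopologicalSpace M] [ChartedSpace H M] [IsManifold I ∞ M]

/-- The field is constant in the trivialization. Such fields supply local frames and test fields. -/
theorem contMDiffAt_trivializationAt_symm (x : M) (v : E) :
    ContMDiffAt I I.tangent ∞
      (fun y ↦ (⟨y, (trivializationAt E (TangentSpace I) x).symm y v⟩ : TangentBundle I M)) x := by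
  have hx := FiberBundle.mem_baseSet_trivializationAt' (F := E) (E := TangentSpace I) x
  refine ((trivializationAt E (TangentSpace I) x).contMDiffAt_section_iff hx).2 ?_
  refine (contMDiffAt_const (c := v)).congr_of_eventuallyEq ?_
  filter_upwards [(trivializationAt E (TangentSpace I) x).open_baseSet.mem_nhds hx] with y hy
  exact congrArg Prod.snd ((trivializationAt E (TangentSpace I) x).apply_mk_symm hy v)

theorem contMDiffAt_extend {x : M} (v : TangentSpace I x) :
    ContMDiffAt I I.tangent ∞
      (fun y ↦ (⟨y, FiberBundle.extend E v y⟩ : TangentBundle I M)) x :=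
  contMDiffAt_trivializationAt_symm x _

end Extension

/-! ### Smoothness of gradients, brackets and the Levi-Civita derivative. -/

namespace PseudoRiemannianMetric

variable {E : Type*} [NormedAddCommGroup E] [NormedSpace ℝ E]
  {H : Type*} [TopologicalSpace H] {I : ModelWithCorners ℝ E H}
  {M : Type*} [TopologicalSpace M] [ChartedSpace H M] [IsManifold I ∞ M]
  (g : PseudoRiemannianMetric I M)

theorem contMDiffAt_pair {X Y : Π x : M, TangentSpace I x} {x : M}
    (hX : ContMDiffAt I I.tangent ∞ (fun y ↦ (⟨y, X y⟩ : TangentBundle I M)) x)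
    (hY : ContMDiffAt I I.tangent ∞ (fun y ↦ (⟨y, Y y⟩ : TangentBundle I M)) x) :
    ContMDiffAt I 𝓘(ℝ, ℝ) ∞ (g.pair X Y) x := by
  have := ContMDiffAt.clm_bundle_apply₂ (F₁ := E) (F₂ := E) (F₃ := ℝ)
    (E₃ := Bundle.Trivial M ℝ) (g.contMDiff x) hX hY
  exact (Bundle.contMDiffAt_section (IB := I) (F := ℝ) (E := Bundle.Trivial M ℝ) _).1 this

variable [FiniteDimensional ℝ E]

/-- A vector field is smooth as soon as its scalar products with smooth vector fields are. -/
theorem contMDiffAt_of_pair {A : Π x : M, TangentSpace I x} {x : M}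
    (hA : ∀ Z : Π x : M, TangentSpace I x,
      ContMDiffAt I I.tangent ∞ (fun y ↦ (⟨y, Z y⟩ : TangentBundle I M)) x →
      ContMDiffAt I 𝓘(ℝ, ℝ) ∞ (g.pair A Z) x) :
    ContMDiffAt I I.tangent ∞ (fun y ↦ (⟨y, A y⟩ : TangentBundle I M)) x := by
  have : CompleteSpace E := FiniteDimensional.complete ℝ E
  set t := trivializationAt E (TangentSpace I) x with ht
  have hx : x ∈ t.baseSet := FiberBundle.mem_baseSet_trivializationAt' (F := E) x
  -- `G` is the metric read in the trivialization, as a map to the dual. It is smooth and pointwise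
  -- invertible by nondegeneracy, so `A` is recovered as `G⁻¹ (G A)`.
  set G : M → E →L[ℝ] E →L[ℝ] ℝ := fun y ↦
    ContinuousLinearMap.inCoordinates E (TangentSpace I) (E →L[ℝ] ℝ)
      (fun y ↦ TangentSpace I y →L[ℝ] Bundle.Trivial M ℝ y) x y x y (g.val y) with hG
  have hGs : ContMDiffAt I 𝓘(ℝ, E →L[ℝ] E →L[ℝ] ℝ) ∞ G x :=
    ((contMDiffAt_hom_bundle _).1 (g.contMDiff x)).2
  have hGa : ∀ y ∈ t.baseSet, ∀ u v, G y u v = g.val y (t.symm y u) (t.symm y v) := by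
    intro y hy u v
    rw [hG, inCoordinates_apply_eq₂ hy hy (Set.mem_univ _)]
    simp [ht]
  have hGi : ∀ y ∈ t.baseSet, (G y).IsInvertible := by
    intro y hy
    have hinj : Function.Injective (G y) := by
      refine (injective_iff_map_eq_zero _).2 fun u hu ↦ ?_
      have h0 : t.symm y u = 0 := by
        refine g.nondegenerate y _ fun w ↦ ?_
        have := hGa y hy u (t ⟨y, w⟩).2
        rw [hu, t.symm_apply_apply_mk hy] at this
        exact this.symm
      calc u = (t ⟨y, t.symm y u⟩).2 := (congrArg Prod.snd (t.apply_mk_symm hy u)).symm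
        _ = (t ⟨y, 0⟩).2 := by rw [h0]
        _ = 0 := congrArg Prod.snd (t.zeroSection ℝ hy)
    have hfr : Module.finrank ℝ E = Module.finrank ℝ (E →L[ℝ] ℝ) :=
      ((LinearMap.toContinuousLinearMap : (E →ₗ[ℝ] ℝ) ≃ₗ[ℝ] (E →L[ℝ] ℝ)).finrank_eq.symm.trans
        Subspace.dual_finrank_eq).symm
    exact ⟨(LinearEquiv.ofInjectiveOfFinrankEq (G y).toLinearMap hinj hfr).toContinuousLinearEquiv,
      by ext; rfl⟩
  -- In the dual basis the coefficients of `G A` are the pairings of `A` with the local frame, which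
  -- are smooth by hypothesis.
  have hβ : ContMDiffAt I 𝓘(ℝ, E →L[ℝ] ℝ) ∞ (fun y ↦ G y (t ⟨y, A y⟩).2) x := by
    let b := Module.finBasis ℝ E
    have h1 : ContMDiffAt I 𝓘(ℝ, E →L[ℝ] ℝ) ∞ (fun y ↦ ∑ i,
        g.pair A (fun z ↦ t.symm z (b i)) y • LinearMap.toContinuousLinearMap (b.coord i)) x :=
      ContMDiffAt.sum fun i _ ↦
        (hA _ (contMDiffAt_trivializationAt_symm x (b i))).smul contMDiffAt_const
    refine h1.congr_of_eventuallyEq ?_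
    filter_upwards [t.open_baseSet.mem_nhds hx] with y hy
    refine ContinuousLinearMap.coe_injective (b.ext fun j ↦ ?_)
    simp [hGa y hy, pair, t.symm_apply_apply_mk hy, Finsupp.single_apply]
  refine (t.contMDiffAt_section_iff hx).2 ?_
  obtain ⟨e, he⟩ := hGi x hx
  -- Operator inversion is smooth at an invertible operator.
  have h2 : ContMDiffAt I 𝓘(ℝ, (E →L[ℝ] ℝ) →L[ℝ] E) ∞ (fun y ↦ (G y).inverse) x :=
    ContDiffAt.comp_contMDiffAt (g := ContinuousLinearMap.inverse)
      (he ▸ contDiffAt_map_inverse e) hGs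
  refine (h2.clm_apply hβ).congr_of_eventuallyEq ?_
  filter_upwards [t.open_baseSet.mem_nhds hx] with y hy
  exact ((hGi y hy).inverse_apply_self _).symm

theorem contMDiffAt_grad {f : M → ℝ} {x : M} (hf : ContMDiffAt I 𝓘(ℝ, ℝ) ∞ f x) :
    ContMDiffAt I I.tangent ∞ (fun y ↦ (⟨y, g.grad f y⟩ : TangentBundle I M)) x := by
  refine g.contMDiffAt_of_pair fun Z hZ ↦ ?_
  have : g.pair (g.grad f) Z = fun y ↦ mvfderiv I f y (Z y) := by
    ext y; exact g.val_flatEquiv_symm y _ _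
  rw [this]
  exact hf.mvfderiv_apply hZ

theorem contMDiffAt_mlieBracket {X Y : Π x : M, TangentSpace I x} {x : M}
    (hX : ContMDiffAt I I.tangent ∞ (fun y ↦ (⟨y, X y⟩ : TangentBundle I M)) x)
    (hY : ContMDiffAt I I.tangent ∞ (fun y ↦ (⟨y, Y y⟩ : TangentBundle I M)) x) :
    ContMDiffAt I I.tangent ∞
      (fun y ↦ (⟨y, VectorField.mlieBracket I X Y y⟩ : TangentBundle I M)) x := by
  have : CompleteSpace E := FiniteDimensional.complete ℝ E
  have : IsManifold I (((⊤ : ℕ∞) : WithTop ℕ∞) + 1) M := by simpa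
  have : IsManifold I (minSmoothness ℝ 2) M := by simpa using inferInstanceAs (IsManifold I 2 M)
  exact ContMDiffAt.mlieBracket_vectorField (m := ⊤) (n := ⊤) hX hY (by simp)

theorem contMDiffAt_koszul {X Y Z : Π x : M, TangentSpace I x} {x : M}
    (hX : ContMDiffAt I I.tangent ∞ (fun y ↦ (⟨y, X y⟩ : TangentBundle I M)) x)
    (hY : ContMDiffAt I I.tangent ∞ (fun y ↦ (⟨y, Y y⟩ : TangentBundle I M)) x)
    (hZ : ContMDiffAt I I.tangent ∞ (fun y ↦ (⟨y, Z y⟩ : TangentBundle I M)) x) :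
    ContMDiffAt I 𝓘(ℝ, ℝ) ∞ (g.koszul X Y Z) x :=
  ((((((g.contMDiffAt_pair hY hZ).mvfderiv_apply hX).add
    ((g.contMDiffAt_pair hX hZ).mvfderiv_apply hY)).sub
    ((g.contMDiffAt_pair hX hY).mvfderiv_apply hZ)).add
    (g.contMDiffAt_pair (contMDiffAt_mlieBracket hX hY) hZ)).sub
    (g.contMDiffAt_pair (contMDiffAt_mlieBracket hX hZ) hY)).sub
    (g.contMDiffAt_pair (contMDiffAt_mlieBracket hY hZ) hX)

theorem contMDiffAt_cov {X Y : Π x : M, TangentSpace I x} {x : M}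
    (hX : ContMDiffAt I I.tangent ∞ (fun y ↦ (⟨y, X y⟩ : TangentBundle I M)) x)
    (hY : ContMDiffAt I I.tangent ∞ (fun y ↦ (⟨y, Y y⟩ : TangentBundle I M)) x) :
    ContMDiffAt I I.tangent ∞ (fun y ↦ (⟨y, g.cov X Y y⟩ : TangentBundle I M)) x := by
  refine g.contMDiffAt_of_pair fun Z hZ ↦ ?_
  refine ((contMDiffAt_const (I' := 𝓘(ℝ, ℝ)) (c := (2⁻¹ : ℝ))).smul
    (g.contMDiffAt_koszul hX hY hZ)).congr_of_eventuallyEq ?_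
  -- The Koszul formula is needed at all nearby points, and `cov` takes its default value `0` where
  -- a field is not differentiable.
  filter_upwards [eventually_contMDiffAt_one hX, eventually_contMDiffAt_one hY,
    eventually_contMDiffAt_one hZ] with y h1 h2 h3
  have := g.two_mul_val_cov (h1.mdifferentiableAt (by simp)) (h2.mdifferentiableAt (by simp))
    (h3.mdifferentiableAt (by simp))
  change g.val y (g.cov X Y y) (Z y) = 2⁻¹ * g.koszul X Y Z y
  linarith

/-- The Koszul formula determines the Levi-Civita covariant derivative. -/
theorem cov_eq_of_koszul {X Y : Π x : M, TangentSpace I x} {x : M}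
    (hX : MDifferentiableAt I I.tangent (fun y ↦ (⟨y, X y⟩ : TangentBundle I M)) x)
    (hY : MDifferentiableAt I I.tangent (fun y ↦ (⟨y, Y y⟩ : TangentBundle I M)) x)
    {v : TangentSpace I x}
    (hv : ∀ Z : Π x : M, TangentSpace I x,
      ContMDiffAt I I.tangent ∞ (fun y ↦ (⟨y, Z y⟩ : TangentBundle I M)) x →
      2 * g.val x v (Z x) = g.koszul X Y Z x) :
    g.cov X Y x = v := by
  rw [← sub_eq_zero]
  refine g.nondegenerate x _ fun w ↦ ?_
  -- Every tangent vector is the value of a field smooth at the point, so testing on fields tests on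
  -- all vectors.
  have hw := contMDiffAt_extend w
  have h1 := g.two_mul_val_cov hX hY (hw.mdifferentiableAt (by simp))
  have h2 := hv _ hw
  rw [FiberBundle.extend_apply_self] at h1 h2
  rw [map_sub, sub_apply]
  linarith

end PseudoRiemannianMetric

/-! ### Calculus of directional derivatives and of smooth vector fields. -/

section DirDeriv

variable {E : Type*} [NormedAddCommGroup E] [NormedSpace ℝ E]
  {H : Type*} [TopologicalSpace H] {I : ModelWithCorners ℝ E H}
  {M : Type*} [TopologicalSpace M] [ChartedSpace H M]
  {X : Π x : M, TangentSpace I x} {f h : M → ℝ} {x : M}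

theorem dirDeriv_add (hf : MDifferentiableAt I 𝓘(ℝ, ℝ) f x) (hh : MDifferentiableAt I 𝓘(ℝ, ℝ) h x) :
    dirDeriv X (f + h) x = dirDeriv X f x + dirDeriv X h x := by
  simp [dirDeriv, mvfderiv_add hf hh]

theorem dirDeriv_mul (hf : MDifferentiableAt I 𝓘(ℝ, ℝ) f x) (hh : MDifferentiableAt I 𝓘(ℝ, ℝ) h x) :
    dirDeriv X (f * h) x = f x * dirDeriv X h x + h x * dirDeriv X f x := by
  simp [dirDeriv, mvfderiv_mul hf hh]

theorem dirDeriv_div [IsManifold I ∞ M] (hf : ContMDiff I 𝓘(ℝ, ℝ) ∞ f)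
    (hh : ContMDiff I 𝓘(ℝ, ℝ) ∞ h) (h0 : ∀ y, h y ≠ 0) :
    dirDeriv X (f / h) x = dirDeriv X f x / h x - f x * dirDeriv X h x / h x ^ 2 := by
  have hd : MDifferentiableAt I 𝓘(ℝ, ℝ) (f / h) x :=
    ((hf.div₀ hh h0) x).mdifferentiableAt (by simp)
  -- The quotient rule comes from the product rule, solved for the derivative of `f / h`.
  have e : f = f / h * h := by ext y; simp [h0 y]
  have key := dirDeriv_mul (X := X) hd ((hh x).mdifferentiableAt (by simp))
  rw [← e, Pi.div_apply] at key
  rw [key]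
  field_simp [h0 x]
  ring

end DirDeriv

section SmoothField

variable {E : Type*} [NormedAddCommGroup E] [NormedSpace ℝ E]
  {H : Type*} [TopologicalSpace H] {I : ModelWithCorners ℝ E H}
  {M : Type*} [TopologicalSpace M] [ChartedSpace H M] [IsManifold I ∞ M]
  {X Y : Π x : M, TangentSpace I x} {f : M → ℝ}

namespace IsSmoothVectorField

theorem mdifferentiableAt (hX : IsSmoothVectorField X) (x : M) :
    MDifferentiableAt I I.tangent (fun y ↦ (⟨y, X y⟩ : TangentBundle I M)) x :=
  (hX x).mdifferentiableAt (by simp)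

theorem add (hX : IsSmoothVectorField X) (hY : IsSmoothVectorField Y) :
    IsSmoothVectorField (X + Y) :=
  ContMDiff.add_section hX hY

theorem sub (hX : IsSmoothVectorField X) (hY : IsSmoothVectorField Y) :
    IsSmoothVectorField (X - Y) :=
  ContMDiff.sub_section hX hY

theorem smul (hf : ContMDiff I 𝓘(ℝ, ℝ) ∞ f) (hX : IsSmoothVectorField X) :
    IsSmoothVectorField (f • X) :=
  ContMDiff.smul_section hf hX

theorem dirDeriv (hX : IsSmoothVectorField X) (hf : ContMDiff I 𝓘(ℝ, ℝ) ∞ f) :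
    ContMDiff I 𝓘(ℝ, ℝ) ∞ (dirDeriv X f) :=
  fun x ↦ (hf x).mvfderiv_apply (hX x)

theorem pair (g : PseudoRiemannianMetric I M) (hX : IsSmoothVectorField X)
    (hY : IsSmoothVectorField Y) : ContMDiff I 𝓘(ℝ, ℝ) ∞ (g.pair X Y) :=
  fun x ↦ g.contMDiffAt_pair (hX x) (hY x)

variable [FiniteDimensional ℝ E]

theorem mlieBracket (hX : IsSmoothVectorField X) (hY : IsSmoothVectorField Y) :
    IsSmoothVectorField (VectorField.mlieBracket I X Y) :=
  fun x ↦ PseudoRiemannianMetric.contMDiffAt_mlieBracket (hX x) (hY x)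

theorem cov (g : PseudoRiemannianMetric I M) (hX : IsSmoothVectorField X)
    (hY : IsSmoothVectorField Y) : IsSmoothVectorField (g.cov X Y) :=
  fun x ↦ g.contMDiffAt_cov (hX x) (hY x)

theorem grad (g : PseudoRiemannianMetric I M) (hf : ContMDiff I 𝓘(ℝ, ℝ) ∞ f) :
    IsSmoothVectorField (g.grad f) :=
  fun x ↦ g.contMDiffAt_grad (hf x)

end IsSmoothVectorField

end SmoothField

/-! ### Leibniz rules, torsion-freeness and metric compatibility. -/

namespace PseudoRiemannianMetric

variable {E : Type*} [NormedAddCommGroup E] [NormedSpace ℝ E]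
  {H : Type*} [TopologicalSpace H] {I : ModelWithCorners ℝ E H}
  {M : Type*} [TopologicalSpace M] [ChartedSpace H M] [IsManifold I ∞ M]
  (g : PseudoRiemannianMetric I M) {X Y Z : Π x : M, TangentSpace I x} {f : M → ℝ} {x : M}

theorem pair_comm (X Y : Π x : M, TangentSpace I x) : g.pair X Y = g.pair Y X :=
  funext fun x ↦ g.symm x _ _

variable [FiniteDimensional ℝ E]

theorem pair_grad_left (f : M → ℝ) (X : Π x : M, TangentSpace I x) :
    g.pair (g.grad f) X = dirDeriv X f :=
  funext fun x ↦ g.val_flatEquiv_symm x _ _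

theorem pair_grad_right (f : M → ℝ) (X : Π x : M, TangentSpace I x) :
    g.pair X (g.grad f) = dirDeriv X f := by
  rw [pair_comm, pair_grad_left]

theorem koszul_add_middle {Y' : Π x : M, TangentSpace I x}
    (hX : MDifferentiableAt I I.tangent (fun y ↦ (⟨y, X y⟩ : TangentBundle I M)) x)
    (hY : MDifferentiableAt I I.tangent (fun y ↦ (⟨y, Y y⟩ : TangentBundle I M)) x)
    (hY' : MDifferentiableAt I I.tangent (fun y ↦ (⟨y, Y' y⟩ : TangentBundle I M)) x)
    (hZ : MDifferentiableAt I I.tangent (fun y ↦ (⟨y, Z y⟩ : TangentBundle I M)) x) :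
    g.koszul X (Y + Y') Z x = g.koszul X Y Z x + g.koszul X Y' Z x := by
  have : CompleteSpace E := FiniteDimensional.complete ℝ E
  have e1 : g.pair (Y + Y') Z = g.pair Y Z + g.pair Y' Z := by ext y; simp [pair]
  have e2 : g.pair X (Y + Y') = g.pair X Y + g.pair X Y' := by ext y; simp [pair]
  simp only [koszul, e1, e2,
    dirDeriv_add (g.mdifferentiableAt_pair hY hZ) (g.mdifferentiableAt_pair hY' hZ),
    dirDeriv_add (g.mdifferentiableAt_pair hX hY) (g.mdifferentiableAt_pair hX hY')]
  simp only [pair, dirDeriv, VectorField.mlieBracket_add_right hY hY',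
    VectorField.mlieBracket_add_left hY hY']
  simp
  ring

/-- The middle slot is a derivation rather than tensorial: the two `Z(f)` terms cancel, while the
`X(f)` terms from `X(g(fY, Z))` and from `[X, fY]` add up. -/
theorem koszul_smul_middle
    (hf : MDifferentiableAt I 𝓘(ℝ, ℝ) f x)
    (hX : MDifferentiableAt I I.tangent (fun y ↦ (⟨y, X y⟩ : TangentBundle I M)) x)
    (hY : MDifferentiableAt I I.tangent (fun y ↦ (⟨y, Y y⟩ : TangentBundle I M)) x)
    (hZ : MDifferentiableAt I I.tangent (fun y ↦ (⟨y, Z y⟩ : TangentBundle I M)) x) :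
    g.koszul X (f • Y) Z x = f x * g.koszul X Y Z x + 2 * (dirDeriv X f x * g.pair Y Z x) := by
  have : CompleteSpace E := FiniteDimensional.complete ℝ E
  have e1 : g.pair (f • Y) Z = f * g.pair Y Z := by ext y; simp [pair]
  have e2 : g.pair X (f • Y) = f * g.pair X Y := by ext y; simp [pair]
  simp only [koszul, e1, e2,
    dirDeriv_mul hf (g.mdifferentiableAt_pair hY hZ),
    dirDeriv_mul hf (g.mdifferentiableAt_pair hX hY)]
  simp only [pair, dirDeriv, VectorField.mlieBracket_smul_right hf hY,
    VectorField.mlieBracket_smul_left hf hY]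
  simp [g.symm x (Y x)]
  ring

theorem cov_add_right {Y' : Π x : M, TangentSpace I x}
    (hX : MDifferentiableAt I I.tangent (fun y ↦ (⟨y, X y⟩ : TangentBundle I M)) x)
    (hY : MDifferentiableAt I I.tangent (fun y ↦ (⟨y, Y y⟩ : TangentBundle I M)) x)
    (hY' : MDifferentiableAt I I.tangent (fun y ↦ (⟨y, Y' y⟩ : TangentBundle I M)) x) :
    g.cov X (Y + Y') x = g.cov X Y x + g.cov X Y' x := by
  refine g.cov_eq_of_koszul hX (mdifferentiableAt_add_section hY hY') fun Z hZ ↦ ?_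
  have hZ := hZ.mdifferentiableAt (by simp)
  rw [g.koszul_add_middle hX hY hY' hZ, ← g.two_mul_val_cov hX hY hZ,
    ← g.two_mul_val_cov hX hY' hZ, map_add, add_apply]
  ring

theorem cov_smul_right (hf : MDifferentiableAt I 𝓘(ℝ, ℝ) f x)
    (hX : MDifferentiableAt I I.tangent (fun y ↦ (⟨y, X y⟩ : TangentBundle I M)) x)
    (hY : MDifferentiableAt I I.tangent (fun y ↦ (⟨y, Y y⟩ : TangentBundle I M)) x) :
    g.cov X (f • Y) x = dirDeriv X f x • Y x + f x • g.cov X Y x := by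
  refine g.cov_eq_of_koszul hX (hf.smul_section hY) fun Z hZ ↦ ?_
  have hZ := hZ.mdifferentiableAt (by simp)
  rw [g.koszul_smul_middle hf hX hY hZ, ← g.two_mul_val_cov hX hY hZ]
  simp [pair]
  ring

theorem cov_sub_right {Y' : Π x : M, TangentSpace I x}
    (hX : MDifferentiableAt I I.tangent (fun y ↦ (⟨y, X y⟩ : TangentBundle I M)) x)
    (hY : MDifferentiableAt I I.tangent (fun y ↦ (⟨y, Y y⟩ : TangentBundle I M)) x)
    (hY' : MDifferentiableAt I I.tangent (fun y ↦ (⟨y, Y' y⟩ : TangentBundle I M)) x) :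
    g.cov X (Y - Y') x = g.cov X Y x - g.cov X Y' x := by
  have h := g.cov_add_right hX (mdifferentiableAt_sub_section hY hY') hY'
  rw [sub_add_cancel] at h
  rw [h, add_sub_cancel_right]

/-- Disposes of the term `∇_[X,V]` when a base lift meets a fibre lift. -/
theorem cov_zero_left
    (hY : MDifferentiableAt I I.tangent (fun y ↦ (⟨y, Y y⟩ : TangentBundle I M)) x) :
    g.cov 0 Y x = 0 := by
  refine g.cov_eq_of_koszul (X := 0) (Bundle.mdifferentiable_zeroSection ℝ (TangentSpace I) x) hY fun Z _ ↦ ?_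
  have e1 : ∀ A : Π x : M, TangentSpace I x, g.pair 0 A = 0 := by
    intro A; ext y; simp [pair]
  simp only [koszul, e1, VectorField.mlieBracket_zero_left]
  simp [dirDeriv, pair]

/-- The Levi-Civita covariant derivative is torsion free. -/
theorem cov_sub_cov_swap
    (hX : MDifferentiableAt I I.tangent (fun y ↦ (⟨y, X y⟩ : TangentBundle I M)) x)
    (hY : MDifferentiableAt I I.tangent (fun y ↦ (⟨y, Y y⟩ : TangentBundle I M)) x) :
    g.cov X Y x - g.cov Y X x = VectorField.mlieBracket I X Y x := by
  rw [sub_eq_iff_eq_add]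
  refine g.cov_eq_of_koszul hX hY fun Z hZ ↦ ?_
  have hZ := hZ.mdifferentiableAt (by simp)
  have e := g.two_mul_val_cov hY hX hZ
  rw [map_add, add_apply, mul_add, e]
  simp only [koszul, g.pair_comm Y X, VectorField.mlieBracket_swap (V := Y) (W := X)]
  simp [pair]
  ring

/-- The Levi-Civita covariant derivative is compatible with the metric. -/
theorem dirDeriv_pair
    (hX : MDifferentiableAt I I.tangent (fun y ↦ (⟨y, X y⟩ : TangentBundle I M)) x)
    (hY : MDifferentiableAt I I.tangent (fun y ↦ (⟨y, Y y⟩ : TangentBundle I M)) x)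
    (hZ : MDifferentiableAt I I.tangent (fun y ↦ (⟨y, Z y⟩ : TangentBundle I M)) x) :
    dirDeriv X (g.pair Y Z) x = g.pair (g.cov X Y) Z x + g.pair Y (g.cov X Z) x := by
  have e1 := g.two_mul_val_cov hX hY hZ
  have e2 := g.two_mul_val_cov hX hZ hY
  rw [g.pair_comm Y (g.cov X Z)]
  simp only [koszul, g.pair_comm Z Y, VectorField.mlieBracket_swap (V := Z) (W := Y)] at e1 e2
  simp only [pair, Pi.neg_apply, map_neg, neg_apply] at e1 e2 ⊢
  linarith

end PseudoRiemannianMetric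

/-! ### Derivatives along lifts, and brackets of lifts. -/

section Lift

variable {EB : Type*} [NormedAddCommGroup EB] [NormedSpace ℝ EB]
  {HB : Type*} [TopologicalSpace HB] {IB : ModelWithCorners ℝ EB HB}
  {B : Type*} [TopologicalSpace B] [ChartedSpace HB B]
  {EF : Type*} [NormedAddCommGroup EF] [NormedSpace ℝ EF]
  {HF : Type*} [TopologicalSpace HF] {IF : ModelWithCorners ℝ EF HF}
  {F : Type*} [TopologicalSpace F] [ChartedSpace HF F]
  {X Y : Π p : B, TangentSpace IB p} {V W : Π q : F, TangentSpace IF q} {x : B × F}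

theorem dirDeriv_liftBase_comp_fst {f : B → ℝ} (hf : MDifferentiableAt IB 𝓘(ℝ, ℝ) f x.1)
    (X : Π p : B, TangentSpace IB p) :
    dirDeriv (liftBase (IF := IF) X) (f ∘ Prod.fst) x = dirDeriv X f x.1 := by
  rw [dirDeriv, mvfderiv_comp_apply x hf mdifferentiableAt_fst, mfderiv_fst_liftBase]; rfl

theorem dirDeriv_liftBase_comp_snd {h : F → ℝ} (hh : MDifferentiableAt IF 𝓘(ℝ, ℝ) h x.2)
    (X : Π p : B, TangentSpace IB p) :
    dirDeriv (liftBase (IF := IF) X) (h ∘ Prod.snd) x = 0 := by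
  rw [dirDeriv, mvfderiv_comp_apply x hh mdifferentiableAt_snd, mfderiv_snd_liftBase, map_zero]

theorem dirDeriv_liftFiber_comp_fst {f : B → ℝ} (hf : MDifferentiableAt IB 𝓘(ℝ, ℝ) f x.1)
    (V : Π q : F, TangentSpace IF q) :
    dirDeriv (liftFiber (IB := IB) V) (f ∘ Prod.fst) x = 0 := by
  rw [dirDeriv, mvfderiv_comp_apply x hf mdifferentiableAt_fst, mfderiv_fst_liftFiber, map_zero]

theorem dirDeriv_liftFiber_comp_snd {h : F → ℝ} (hh : MDifferentiableAt IF 𝓘(ℝ, ℝ) h x.2)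
    (V : Π q : F, TangentSpace IF q) :
    dirDeriv (liftFiber (IB := IB) V) (h ∘ Prod.snd) x = dirDeriv V h x.2 := by
  rw [dirDeriv, mvfderiv_comp_apply x hh mdifferentiableAt_snd, mfderiv_snd_liftFiber]; rfl

variable [IsManifold IB ∞ B] [IsManifold IF ∞ F]

theorem contMDiffAt_liftBase
    (hX : ContMDiffAt IB IB.tangent ∞ (fun y ↦ (⟨y, X y⟩ : TangentBundle IB B)) x.1) :
    ContMDiffAt (IB.prod IF) (IB.prod IF).tangent ∞
      (fun y ↦ (⟨y, liftBase X y⟩ : TangentBundle (IB.prod IF) (B × F))) x := by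
  have h0 : ContMDiff IF IF.tangent ∞ (fun y : F ↦ (⟨y, 0⟩ : TangentBundle IF F)) :=
    Bundle.contMDiff_zeroSection ℝ (TangentSpace IF)
  exact (contMDiff_equivTangentBundleProd_symm (n := ∞)).contMDiffAt.comp x
    ((hX.comp x contMDiffAt_fst).prodMk ((h0 x.2).comp x contMDiffAt_snd))

theorem contMDiffAt_liftFiber
    (hV : ContMDiffAt IF IF.tangent ∞ (fun y ↦ (⟨y, V y⟩ : TangentBundle IF F)) x.2) :
    ContMDiffAt (IB.prod IF) (IB.prod IF).tangent ∞
      (fun y ↦ (⟨y, liftFiber V y⟩ : TangentBundle (IB.prod IF) (B × F))) x := by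
  have h0 : ContMDiff IB IB.tangent ∞ (fun y : B ↦ (⟨y, 0⟩ : TangentBundle IB B)) :=
    Bundle.contMDiff_zeroSection ℝ (TangentSpace IB)
  exact (contMDiff_equivTangentBundleProd_symm (n := ∞)).contMDiffAt.comp x
    (((h0 x.1).comp x contMDiffAt_fst).prodMk (hV.comp x contMDiffAt_snd))

theorem IsSmoothVectorField.liftBase (hX : IsSmoothVectorField X) :
    IsSmoothVectorField (liftBase X : Π x : B × F, TangentSpace (IB.prod IF) x) :=
  fun x ↦ contMDiffAt_liftBase (hX x.1)

theorem IsSmoothVectorField.liftFiber (hV : IsSmoothVectorField V) :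
    IsSmoothVectorField (liftFiber V : Π x : B × F, TangentSpace (IB.prod IF) x) :=
  fun x ↦ contMDiffAt_liftFiber (hV x.2)

variable [IB.Boundaryless] [IF.Boundaryless] [CompleteSpace EB] [CompleteSpace EF]

/-- A tangent vector of the product is determined by its two projections. The lifts are related to
`X` and `Y` under the first and to zero fields under the second, so naturality of the bracket gives
both components. -/
theorem mlieBracket_liftBase_liftBase
    (hX : ContMDiffAt IB IB.tangent ∞ (fun y ↦ (⟨y, X y⟩ : TangentBundle IB B)) x.1)
    (hY : ContMDiffAt IB IB.tangent ∞ (fun y ↦ (⟨y, Y y⟩ : TangentBundle IB B)) x.1) :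
    VectorField.mlieBracket (IB.prod IF) (liftBase X) (liftBase Y) x =
      liftBase (VectorField.mlieBracket IB X Y) x := by
  have hX' := contMDiffAt_liftBase (IF := IF) hX
  have hY' := contMDiffAt_liftBase (IF := IF) hY
  have h0 : ContMDiff IF IF.tangent ∞ (fun y : F ↦ (⟨y, 0⟩ : TangentBundle IF F)) :=
    Bundle.contMDiff_zeroSection ℝ (TangentSpace IF)
  have h1 := mfderiv_mlieBracket_of_related contMDiff_fst hX' hY' hX hY
    (fun y ↦ mfderiv_fst_liftBase X y) (fun y ↦ mfderiv_fst_liftBase Y y)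
  have h2 := mfderiv_mlieBracket_of_related (V' := 0) (W' := 0) contMDiff_snd hX' hY' (h0 _) (h0 _)
    (fun y ↦ mfderiv_snd_liftBase X y) (fun y ↦ mfderiv_snd_liftBase Y y)
  rw [mfderiv_fst] at h1
  rw [mfderiv_snd, VectorField.mlieBracket_zero_left] at h2
  exact Prod.ext h1 h2

theorem mlieBracket_liftFiber_liftFiber
    (hV : ContMDiffAt IF IF.tangent ∞ (fun y ↦ (⟨y, V y⟩ : TangentBundle IF F)) x.2)
    (hW : ContMDiffAt IF IF.tangent ∞ (fun y ↦ (⟨y, W y⟩ : TangentBundle IF F)) x.2) :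
    VectorField.mlieBracket (IB.prod IF) (liftFiber V) (liftFiber W) x =
      liftFiber (VectorField.mlieBracket IF V W) x := by
  have hV' := contMDiffAt_liftFiber (IB := IB) hV
  have hW' := contMDiffAt_liftFiber (IB := IB) hW
  have h0 : ContMDiff IB IB.tangent ∞ (fun y : B ↦ (⟨y, 0⟩ : TangentBundle IB B)) :=
    Bundle.contMDiff_zeroSection ℝ (TangentSpace IB)
  have h1 := mfderiv_mlieBracket_of_related (V' := 0) (W' := 0) contMDiff_fst hV' hW' (h0 _) (h0 _)
    (fun y ↦ mfderiv_fst_liftFiber V y) (fun y ↦ mfderiv_fst_liftFiber W y)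
  have h2 := mfderiv_mlieBracket_of_related contMDiff_snd hV' hW' hV hW
    (fun y ↦ mfderiv_snd_liftFiber V y) (fun y ↦ mfderiv_snd_liftFiber W y)
  rw [mfderiv_fst, VectorField.mlieBracket_zero_left] at h1
  rw [mfderiv_snd] at h2
  exact Prod.ext h1 h2

/-- Under each projection one of the two fields is related to zero, so both components of the
bracket vanish. -/
theorem mlieBracket_liftBase_liftFiber
    (hX : ContMDiffAt IB IB.tangent ∞ (fun y ↦ (⟨y, X y⟩ : TangentBundle IB B)) x.1)
    (hV : ContMDiffAt IF IF.tangent ∞ (fun y ↦ (⟨y, V y⟩ : TangentBundle IF F)) x.2) :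
    VectorField.mlieBracket (IB.prod IF) (liftBase X) (liftFiber V) x = 0 := by
  have hX' := contMDiffAt_liftBase (IF := IF) hX
  have hV' := contMDiffAt_liftFiber (IB := IB) hV
  have hB : ContMDiff IB IB.tangent ∞ (fun y : B ↦ (⟨y, 0⟩ : TangentBundle IB B)) :=
    Bundle.contMDiff_zeroSection ℝ (TangentSpace IB)
  have hF : ContMDiff IF IF.tangent ∞ (fun y : F ↦ (⟨y, 0⟩ : TangentBundle IF F)) :=
    Bundle.contMDiff_zeroSection ℝ (TangentSpace IF)
  have h1 := mfderiv_mlieBracket_of_related (W' := 0) contMDiff_fst hX' hV' hX (hB _)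
    (fun y ↦ mfderiv_fst_liftBase X y) (fun y ↦ mfderiv_fst_liftFiber V y)
  have h2 := mfderiv_mlieBracket_of_related (V' := 0) contMDiff_snd hX' hV' (hF _) hV
    (fun y ↦ mfderiv_snd_liftBase X y) (fun y ↦ mfderiv_snd_liftFiber V y)
  rw [mfderiv_fst, VectorField.mlieBracket_zero_right] at h1
  rw [mfderiv_snd, VectorField.mlieBracket_zero_left] at h2
  exact Prod.ext h1 h2

theorem mlieBracket_liftFiber_liftBase
    (hX : ContMDiffAt IB IB.tangent ∞ (fun y ↦ (⟨y, X y⟩ : TangentBundle IB B)) x.1)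
    (hV : ContMDiffAt IF IF.tangent ∞ (fun y ↦ (⟨y, V y⟩ : TangentBundle IF F)) x.2) :
    VectorField.mlieBracket (IB.prod IF) (liftFiber V) (liftBase X) x = 0 := by
  rw [VectorField.mlieBracket_swap_apply, mlieBracket_liftBase_liftFiber hX hV, neg_zero]

end Lift

section SquareMul

variable {E : Type*} [NormedAddCommGroup E] [NormedSpace ℝ E]
  {H : Type*} [TopologicalSpace H] {I : ModelWithCorners ℝ E H}
  {M : Type*} [TopologicalSpace M] [ChartedSpace H M]

theorem dirDeriv_sq {f : M → ℝ} {x : M} (hf : MDifferentiableAt I 𝓘(ℝ, ℝ) f x)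
    (X : Π x : M, TangentSpace I x) :
    dirDeriv X (f ^ 2) x = 2 * f x * dirDeriv X f x := by
  rw [sq, dirDeriv_mul hf hf]
  ring

theorem ContMDiff.mdifferentiableAt_sq {f : M → ℝ} (hf : ContMDiff I 𝓘(ℝ, ℝ) ∞ f) (x : M) :
    MDifferentiableAt I 𝓘(ℝ, ℝ) (f ^ 2) x :=
  (hf.pow 2 x).mdifferentiableAt (by simp)

theorem dirDeriv_zero_right (X : Π x : M, TangentSpace I x) (x : M) : dirDeriv X 0 x = 0 := by
  simp [dirDeriv]

end SquareMul

section SquareMulProduct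

variable {EB : Type*} [NormedAddCommGroup EB] [NormedSpace ℝ EB]
  {HB : Type*} [TopologicalSpace HB] {IB : ModelWithCorners ℝ EB HB}
  {B : Type*} [TopologicalSpace B] [ChartedSpace HB B]
  {EF : Type*} [NormedAddCommGroup EF] [NormedSpace ℝ EF]
  {HF : Type*} [TopologicalSpace HF] {IF : ModelWithCorners ℝ EF HF}
  {F : Type*} [TopologicalSpace F] [ChartedSpace HF F] {w : B → ℝ}

theorem dirDeriv_liftBase_sq_mul (hw : ContMDiff IB 𝓘(ℝ, ℝ) ∞ w) {h : F → ℝ} {x : B × F}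
    (hh : MDifferentiableAt IF 𝓘(ℝ, ℝ) h x.2) (X : Π p : B, TangentSpace IB p) :
    dirDeriv (liftBase (IF := IF) X) (((w ^ 2) ∘ Prod.fst) * (h ∘ Prod.snd)) x =
      2 * w x.1 * dirDeriv X w x.1 * h x.2 := by
  have hw1 := (hw x.1).mdifferentiableAt (by simp)
  have hw2 := hw.mdifferentiableAt_sq x.1
  rw [dirDeriv_mul (hw2.comp x mdifferentiableAt_fst) (hh.comp x mdifferentiableAt_snd),
    dirDeriv_liftBase_comp_fst hw2, dirDeriv_liftBase_comp_snd hh, dirDeriv_sq hw1]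
  simp
  ring

theorem dirDeriv_liftFiber_sq_mul (hw : ContMDiff IB 𝓘(ℝ, ℝ) ∞ w) {h : F → ℝ} {x : B × F}
    (hh : MDifferentiableAt IF 𝓘(ℝ, ℝ) h x.2) (V : Π q : F, TangentSpace IF q) :
    dirDeriv (liftFiber (IB := IB) V) (((w ^ 2) ∘ Prod.fst) * (h ∘ Prod.snd)) x =
      w x.1 ^ 2 * dirDeriv V h x.2 := by
  have hw2 := hw.mdifferentiableAt_sq x.1
  rw [dirDeriv_mul (hw2.comp x mdifferentiableAt_fst) (hh.comp x mdifferentiableAt_snd),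
    dirDeriv_liftFiber_comp_fst hw2, dirDeriv_liftFiber_comp_snd hh]
  simp

end SquareMulProduct

/-- The Levi-Civita covariant derivative of the conformal metric `c² g`, in terms of that of `g`. -/
def PseudoRiemannianMetric.conformalCov {E : Type*} [NormedAddCommGroup E] [NormedSpace ℝ E]
    {H : Type*} [TopologicalSpace H] {I : ModelWithCorners ℝ E H}
    {M : Type*} [TopologicalSpace M] [ChartedSpace H M] [IsManifold I ∞ M]
    [FiniteDimensional ℝ E] (g : PseudoRiemannianMetric I M) (c : M → ℝ)
    (X Y : Π x : M, TangentSpace I x) : Π x : M, TangentSpace I x :=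
  g.cov X Y + (dirDeriv X c / c) • Y + (dirDeriv Y c / c) • X - (g.pair X Y / c) • g.grad c

/-! ### The warped metric on lifts, and gradients of functions on the base. -/

section BaseConformalWarpedProduct

variable {EB : Type*} [NormedAddCommGroup EB] [NormedSpace ℝ EB]
  {HB : Type*} [TopologicalSpace HB] {IB : ModelWithCorners ℝ EB HB}
  {B : Type*} [TopologicalSpace B] [ChartedSpace HB B] [IsManifold IB ∞ B]
  {EF : Type*} [NormedAddCommGroup EF] [NormedSpace ℝ EF]
  {HF : Type*} [TopologicalSpace HF] {IF : ModelWithCorners ℝ EF HF}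
  {F : Type*} [TopologicalSpace F] [ChartedSpace HF F] [IsManifold IF ∞ F]
  (gB : PseudoRiemannianMetric IB B) (gF : PseudoRiemannianMetric IF F)
  {c w : B → ℝ} (hc : ContMDiff IB 𝓘(ℝ, ℝ) ∞ c) (hw : ContMDiff IB 𝓘(ℝ, ℝ) ∞ w)
  (hc0 : ∀ p, 0 < c p) (hw0 : ∀ p, 0 < w p)

theorem bcwpMetric_val (x : B × F) (u v : TangentSpace (IB.prod IF) x) :
    (bcwpMetric gB gF c w hc hw hc0 hw0).val x u v =
      c x.1 ^ 2 * gB.val x.1 u.1 v.1 + w x.1 ^ 2 * gF.val x.2 u.2 v.2 := by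
  change scaledPullback gB.val (c ∘ Prod.fst) Prod.fst x u v +
      scaledPullback gF.val (w ∘ Prod.fst) Prod.snd x u v = _
  rw [scaledPullback_apply, scaledPullback_apply, mfderiv_fst, mfderiv_snd]
  rfl

theorem bcwpMetric_val_liftBase (X : Π p : B, TangentSpace IB p) (x : B × F)
    (u : TangentSpace (IB.prod IF) x) :
    (bcwpMetric gB gF c w hc hw hc0 hw0).val x u (liftBase X x) =
      c x.1 ^ 2 * gB.val x.1 u.1 (X x.1) := by
  rw [bcwpMetric_val]
  simp [liftBase]

theorem bcwpMetric_val_liftFiber (V : Π q : F, TangentSpace IF q) (x : B × F)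
    (u : TangentSpace (IB.prod IF) x) :
    (bcwpMetric gB gF c w hc hw hc0 hw0).val x u (liftFiber V x) =
      w x.1 ^ 2 * gF.val x.2 u.2 (V x.2) := by
  rw [bcwpMetric_val]
  simp [liftFiber]

theorem bcwpMetric_pair_liftBase_liftBase (X Y : Π p : B, TangentSpace IB p) :
    (bcwpMetric gB gF c w hc hw hc0 hw0).pair (liftBase X) (liftBase Y) =
      (c ^ 2 * gB.pair X Y) ∘ Prod.fst :=
  funext fun x ↦ bcwpMetric_val_liftBase gB gF hc hw hc0 hw0 Y x (liftBase X x)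

theorem bcwpMetric_pair_liftFiber_liftFiber (V W : Π q : F, TangentSpace IF q) :
    (bcwpMetric gB gF c w hc hw hc0 hw0).pair (liftFiber V) (liftFiber W) =
      ((w ^ 2) ∘ Prod.fst) * (gF.pair V W ∘ Prod.snd) :=
  funext fun x ↦ bcwpMetric_val_liftFiber gB gF hc hw hc0 hw0 W x (liftFiber V x)

theorem bcwpMetric_pair_liftBase_liftFiber (X : Π p : B, TangentSpace IB p)
    (V : Π q : F, TangentSpace IF q) :
    (bcwpMetric gB gF c w hc hw hc0 hw0).pair (liftBase X) (liftFiber V) = 0 := by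
  ext x
  rw [PseudoRiemannianMetric.pair, bcwpMetric_val_liftFiber]
  simp [liftBase]

theorem bcwpMetric_pair_liftFiber_liftBase (X : Π p : B, TangentSpace IB p)
    (V : Π q : F, TangentSpace IF q) :
    (bcwpMetric gB gF c w hc hw hc0 hw0).pair (liftFiber V) (liftBase X) = 0 := by
  rw [PseudoRiemannianMetric.pair_comm, bcwpMetric_pair_liftBase_liftFiber]

variable [FiniteDimensional ℝ EB] [FiniteDimensional ℝ EF]

/-- On a product, the Koszul formula has to be checked on lifts only. -/
theorem cov_eq_of_koszul_lift (g : PseudoRiemannianMetric (IB.prod IF) (B × F))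
    {S T : Π x : B × F, TangentSpace (IB.prod IF) x}
    (hS : IsSmoothVectorField S) (hT : IsSmoothVectorField T) {x : B × F}
    {v : TangentSpace (IB.prod IF) x}
    (hB : ∀ A : Π p : B, TangentSpace IB p,
      ContMDiffAt IB IB.tangent ∞ (fun y ↦ (⟨y, A y⟩ : TangentBundle IB B)) x.1 →
      2 * g.val x v (liftBase A x) = g.koszul S T (liftBase A) x)
    (hF : ∀ C : Π q : F, TangentSpace IF q,
      ContMDiffAt IF IF.tangent ∞ (fun y ↦ (⟨y, C y⟩ : TangentBundle IF F)) x.2 →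
      2 * g.val x v (liftFiber C x) = g.koszul S T (liftFiber C) x) :
    g.cov S T x = v := by
  rw [← sub_eq_zero]
  refine g.nondegenerate x _ fun u ↦ ?_
  -- The two components of `u` are extended separately on the factors, which writes `u` as a sum of
  -- lifts; the extensions are known to be smooth only at the point, hence the local hypotheses of
  -- `hB` and `hF`.
  obtain ⟨A, hA, hAx⟩ : ∃ A : Π p : B, TangentSpace IB p,
      ContMDiffAt IB IB.tangent ∞ (fun y ↦ (⟨y, A y⟩ : TangentBundle IB B)) x.1 ∧ A x.1 = u.1 :=
    ⟨_, contMDiffAt_extend (I := IB) (x := x.1) u.1, FiberBundle.extend_apply_self _ _⟩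
  obtain ⟨C, hC, hCx⟩ : ∃ C : Π q : F, TangentSpace IF q,
      ContMDiffAt IF IF.tangent ∞ (fun y ↦ (⟨y, C y⟩ : TangentBundle IF F)) x.2 ∧ C x.2 = u.2 :=
    ⟨_, contMDiffAt_extend (I := IF) (x := x.2) u.2, FiberBundle.extend_apply_self _ _⟩
  have e : u = liftBase A x + liftFiber C x :=
    Prod.ext ((add_zero (A x.1)).trans hAx).symm ((zero_add (C x.2)).trans hCx).symm
  have h1 := hB _ hA
  have h2 := hF _ hC
  rw [← g.two_mul_val_cov (hS.mdifferentiableAt x) (hT.mdifferentiableAt x)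
    ((contMDiffAt_liftBase hA).mdifferentiableAt (by simp))] at h1
  rw [← g.two_mul_val_cov (hS.mdifferentiableAt x) (hT.mdifferentiableAt x)
    ((contMDiffAt_liftFiber hC).mdifferentiableAt (by simp))] at h2
  rw [e, map_add, map_sub, sub_apply, sub_apply]
  linarith

/-- The differential of `f ∘ Prod.fst` kills fibre directions, and `1 / c ^ 2` compensates the
conformal factor on the base. -/
theorem bcwpMetric_grad_comp_fst {f : B → ℝ} (hf : ContMDiff IB 𝓘(ℝ, ℝ) ∞ f) :
    (bcwpMetric gB gF c w hc hw hc0 hw0).grad (f ∘ Prod.fst) =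
      liftBase ((1 / c ^ 2) • gB.grad f) := by
  ext1 x
  rw [← sub_eq_zero]
  refine (bcwpMetric gB gF c w hc hw hc0 hw0).nondegenerate x _ fun u ↦ ?_
  rw [map_sub, sub_apply, PseudoRiemannianMetric.grad,
    PseudoRiemannianMetric.val_flatEquiv_symm, bcwpMetric_val,
    mvfderiv_comp_apply x ((hf _).mdifferentiableAt (by simp)) mdifferentiableAt_fst, mfderiv_fst]
  have key : ∀ (a : TangentSpace IB x.1) (b : TangentSpace IF x.2),
      mvfderiv IB f x.1 a - (c x.1 ^ 2 * gB.val x.1 ((1 / c x.1 ^ 2) • gB.grad f x.1) a +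
        w x.1 ^ 2 * gF.val x.2 0 b) = 0 := by
    intro a b
    have h := gB.val_flatEquiv_symm x.1 (mvfderiv IB f x.1) a
    have h0 := (hc0 x.1).ne'
    rw [PseudoRiemannianMetric.grad, map_smul, smul_apply, h, map_zero]
    simp [h0]
  exact key u.1 u.2

end BaseConformalWarpedProduct

/-! ### The Levi-Civita derivative on lifts. -/

section BaseConformalWarpedProduct

variable {EB : Type*} [NormedAddCommGroup EB] [NormedSpace ℝ EB]
  {HB : Type*} [TopologicalSpace HB] {IB : ModelWithCorners ℝ EB HB}
  {B : Type*} [TopologicalSpace B] [ChartedSpace HB B] [IsManifold IB ∞ B]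
  {EF : Type*} [NormedAddCommGroup EF] [NormedSpace ℝ EF]
  {HF : Type*} [TopologicalSpace HF] {IF : ModelWithCorners ℝ EF HF}
  {F : Type*} [TopologicalSpace F] [ChartedSpace HF F] [IsManifold IF ∞ F]
  (gB : PseudoRiemannianMetric IB B) (gF : PseudoRiemannianMetric IF F)
  {c w : B → ℝ} (hc : ContMDiff IB 𝓘(ℝ, ℝ) ∞ c) (hw : ContMDiff IB 𝓘(ℝ, ℝ) ∞ w)
  (hc0 : ∀ p, 0 < c p) (hw0 : ∀ p, 0 < w p)
  [FiniteDimensional ℝ EB] [FiniteDimensional ℝ EF] [IB.Boundaryless] [IF.Boundaryless]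
  {X Y : Π p : B, TangentSpace IB p} {V W : Π q : F, TangentSpace IF q}

/-- Against base lifts the Koszul expression is that of `c² g_B`. Against fibre lifts it vanishes,
because `g(X, Y)` depends on the base only and the brackets contribute nothing. -/
theorem bcwpMetric_cov_liftBase_liftBase (hX : IsSmoothVectorField X)
    (hY : IsSmoothVectorField Y) :
    (bcwpMetric gB gF c w hc hw hc0 hw0).cov (liftBase X) (liftBase Y) =
      liftBase (gB.conformalCov c X Y) := by
  have : CompleteSpace EB := FiniteDimensional.complete ℝ EB
  have : CompleteSpace EF := FiniteDimensional.complete ℝ EF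
  ext1 x
  have hcd := (hc x.1).mdifferentiableAt (by simp)
  have hcd2 := hc.mdifferentiableAt_sq x.1
  have hXd := hX.mdifferentiableAt x.1
  have hYd := hY.mdifferentiableAt x.1
  refine cov_eq_of_koszul_lift _ hX.liftBase hY.liftBase (fun A hA ↦ ?_) (fun C hC ↦ ?_)
  · have hAd := hA.mdifferentiableAt (by simp)
    have hYA := gB.mdifferentiableAt_pair hYd hAd
    have hXA := gB.mdifferentiableAt_pair hXd hAd
    have hXY := gB.mdifferentiableAt_pair hXd hYd
    have hK := gB.two_mul_val_cov hXd hYd hAd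
    have hG : gB.val x.1 (gB.grad c x.1) (A x.1) = dirDeriv A c x.1 :=
      congrFun (gB.pair_grad_left c A) x.1
    have h0 := (hc0 x.1).ne'
    have lhs : (bcwpMetric gB gF c w hc hw hc0 hw0).val x
        (liftBase (gB.conformalCov c X Y) x) (liftBase A x) =
        c x.1 ^ 2 * (gB.val x.1 (gB.cov X Y x.1) (A x.1) +
          dirDeriv X c x.1 / c x.1 * gB.val x.1 (Y x.1) (A x.1) +
          dirDeriv Y c x.1 / c x.1 * gB.val x.1 (X x.1) (A x.1) -
          gB.val x.1 (X x.1) (Y x.1) / c x.1 * dirDeriv A c x.1) := by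
      rw [bcwpMetric_val_liftBase, ← hG]
      change c x.1 ^ 2 * gB.val x.1 (gB.conformalCov c X Y x.1) (A x.1) = _
      simp [PseudoRiemannianMetric.conformalCov, PseudoRiemannianMetric.pair]
    rw [lhs]
    simp only [PseudoRiemannianMetric.koszul, bcwpMetric_pair_liftBase_liftBase]
    rw [dirDeriv_liftBase_comp_fst (hcd2.mul hYA), dirDeriv_liftBase_comp_fst (hcd2.mul hXA),
      dirDeriv_liftBase_comp_fst (hcd2.mul hXY), dirDeriv_mul hcd2 hYA, dirDeriv_mul hcd2 hXA,
      dirDeriv_mul hcd2 hXY, dirDeriv_sq hcd, dirDeriv_sq hcd, dirDeriv_sq hcd]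
    simp only [PseudoRiemannianMetric.pair, bcwpMetric_val_liftBase,
      mlieBracket_liftBase_liftBase (IF := IF) (hX x.1) (hY x.1),
      mlieBracket_liftBase_liftBase (IF := IF) (hX x.1) hA,
      mlieBracket_liftBase_liftBase (IF := IF) (hY x.1) hA]
    simp only [PseudoRiemannianMetric.koszul, PseudoRiemannianMetric.pair] at hK
    simp only [liftBase, Pi.pow_apply]
    field_simp
    linear_combination c x.1 * hK
  · have hl : ∀ D : Π p : B, TangentSpace IB p, (bcwpMetric gB gF c w hc hw hc0 hw0).val x
        (liftBase D x) (liftFiber C x) = 0 :=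
      fun D ↦ congrFun (bcwpMetric_pair_liftBase_liftFiber gB gF hc hw hc0 hw0 D C) x
    simp only [PseudoRiemannianMetric.koszul, bcwpMetric_pair_liftBase_liftFiber,
      bcwpMetric_pair_liftBase_liftBase, dirDeriv_zero_right]
    rw [dirDeriv_liftFiber_comp_fst (hcd2.mul (gB.mdifferentiableAt_pair hXd hYd))]
    simp only [PseudoRiemannianMetric.pair, hl,
      mlieBracket_liftBase_liftBase (IF := IF) (hX x.1) (hY x.1),
      mlieBracket_liftBase_liftFiber (hX x.1) hC, mlieBracket_liftBase_liftFiber (hY x.1) hC]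
    simp

/-- Only one Koszul term survives, `X(w² g_F(V, C)) = 2 w X(w) g_F(V, C)`; dividing by `2 g(V, C) =
2 w² g_F(V, C)` gives the factor `X(w)/w`. -/
theorem bcwpMetric_cov_liftBase_liftFiber (hX : IsSmoothVectorField X)
    (hV : IsSmoothVectorField V) :
    (bcwpMetric gB gF c w hc hw hc0 hw0).cov (liftBase X) (liftFiber V) =
      ((dirDeriv X w / w) ∘ Prod.fst : B × F → ℝ) •
        (liftFiber V : Π x : B × F, TangentSpace (IB.prod IF) x) := by
  have : CompleteSpace EB := FiniteDimensional.complete ℝ EB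
  have : CompleteSpace EF := FiniteDimensional.complete ℝ EF
  ext1 x
  have hcd2 := hc.mdifferentiableAt_sq x.1
  have hXd := hX.mdifferentiableAt x.1
  have hVd := hV.mdifferentiableAt x.2
  refine cov_eq_of_koszul_lift _ hX.liftBase hV.liftFiber (fun A hA ↦ ?_) (fun C hC ↦ ?_)
  · have hl : (bcwpMetric gB gF c w hc hw hc0 hw0).val x
        (liftFiber V x) (liftBase A x) = 0 :=
      congrFun (bcwpMetric_pair_liftFiber_liftBase gB gF hc hw hc0 hw0 A V) x
    have hl' : ∀ D : Π p : B, TangentSpace IB p, (bcwpMetric gB gF c w hc hw hc0 hw0).val x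
        (liftBase D x) (liftFiber V x) = 0 :=
      fun D ↦ congrFun (bcwpMetric_pair_liftBase_liftFiber gB gF hc hw hc0 hw0 D V) x
    simp only [PseudoRiemannianMetric.koszul, bcwpMetric_pair_liftBase_liftFiber,
      bcwpMetric_pair_liftFiber_liftBase, bcwpMetric_pair_liftBase_liftBase, dirDeriv_zero_right]
    rw [dirDeriv_liftFiber_comp_fst
      (hcd2.mul (gB.mdifferentiableAt_pair hXd (hA.mdifferentiableAt (by simp))))]
    simp only [PseudoRiemannianMetric.pair, hl',
      mlieBracket_liftBase_liftBase (IF := IF) (hX x.1) hA,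
      mlieBracket_liftBase_liftFiber (hX x.1) (hV x.2),
      mlieBracket_liftFiber_liftBase hA (hV x.2)]
    simp [hl]
  · have hVC := gF.mdifferentiableAt_pair hVd (hC.mdifferentiableAt (by simp))
    have hl : ∀ D : Π q : F, TangentSpace IF q, (bcwpMetric gB gF c w hc hw hc0 hw0).val x
        (liftFiber D x) (liftBase X x) = 0 :=
      fun D ↦ congrFun (bcwpMetric_pair_liftFiber_liftBase gB gF hc hw hc0 hw0 X D) x
    have hVCx : (bcwpMetric gB gF c w hc hw hc0 hw0).val x
        (liftFiber V x) (liftFiber C x) = w x.1 ^ 2 * gF.pair V C x.2 :=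
      bcwpMetric_val_liftFiber gB gF hc hw hc0 hw0 C x _
    simp only [PseudoRiemannianMetric.koszul, bcwpMetric_pair_liftBase_liftFiber,
      bcwpMetric_pair_liftFiber_liftFiber, dirDeriv_zero_right]
    rw [dirDeriv_liftBase_sq_mul hw hVC]
    simp only [PseudoRiemannianMetric.pair, hl,
      mlieBracket_liftFiber_liftFiber (IB := IB) (hV x.2) hC,
      mlieBracket_liftBase_liftFiber (hX x.1) hC,
      mlieBracket_liftBase_liftFiber (hX x.1) (hV x.2)]
    have h0 := (hw0 x.1).ne'
    simp [hVCx]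
    simp [PseudoRiemannianMetric.pair]
    field_simp

/-- Torsion-freeness, since the two lifts commute. -/
theorem bcwpMetric_cov_liftFiber_liftBase (hX : IsSmoothVectorField X)
    (hV : IsSmoothVectorField V) :
    (bcwpMetric gB gF c w hc hw hc0 hw0).cov (liftFiber V) (liftBase X) =
      ((dirDeriv X w / w) ∘ Prod.fst : B × F → ℝ) •
        (liftFiber V : Π x : B × F, TangentSpace (IB.prod IF) x) := by
  have : CompleteSpace EB := FiniteDimensional.complete ℝ EB
  have : CompleteSpace EF := FiniteDimensional.complete ℝ EF
  ext1 x
  have h := (bcwpMetric gB gF c w hc hw hc0 hw0).cov_sub_cov_swap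
    (hV.liftFiber.mdifferentiableAt x) (hX.liftBase.mdifferentiableAt x)
  rwa [mlieBracket_liftFiber_liftBase (hX x.1) (hV x.2), sub_eq_zero,
    bcwpMetric_cov_liftBase_liftFiber gB gF hc hw hc0 hw0 hX hV] at h

/-- Against a base lift `A` only `-A(w²) g_F(V, W)` survives, which is the gradient term. Against
fibre lifts the expression is `w²` times the Koszul expression of `g_F`, as `w` is constant along
the fibre. -/
theorem bcwpMetric_cov_liftFiber_liftFiber (hV : IsSmoothVectorField V)
    (hW : IsSmoothVectorField W) :
    (bcwpMetric gB gF c w hc hw hc0 hw0).cov (liftFiber V) (liftFiber W) =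
      liftFiber (gF.cov V W) - ((w ∘ Prod.fst) * (gF.pair V W ∘ Prod.snd) : B × F → ℝ) •
        (bcwpMetric gB gF c w hc hw hc0 hw0).grad (w ∘ Prod.fst) := by
  have : CompleteSpace EB := FiniteDimensional.complete ℝ EB
  have : CompleteSpace EF := FiniteDimensional.complete ℝ EF
  ext1 x
  have hVd := hV.mdifferentiableAt x.2
  have hWd := hW.mdifferentiableAt x.2
  have hVW := gF.mdifferentiableAt_pair hVd hWd
  have hw1 := (hw x.1).mdifferentiableAt (by simp)
  refine cov_eq_of_koszul_lift _ hV.liftFiber hW.liftFiber (fun A hA ↦ ?_) (fun C hC ↦ ?_)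
  · have hl : ∀ D : Π q : F, TangentSpace IF q, (bcwpMetric gB gF c w hc hw hc0 hw0).val x
        (liftFiber D x) (liftBase A x) = 0 :=
      fun D ↦ congrFun (bcwpMetric_pair_liftFiber_liftBase gB gF hc hw hc0 hw0 A D) x
    have hg := congrFun ((bcwpMetric gB gF c w hc hw hc0 hw0).pair_grad_left (w ∘ Prod.fst)
      (liftBase A)) x
    rw [dirDeriv_liftBase_comp_fst hw1, PseudoRiemannianMetric.pair] at hg
    simp only [PseudoRiemannianMetric.koszul, bcwpMetric_pair_liftFiber_liftBase,
      bcwpMetric_pair_liftFiber_liftFiber, dirDeriv_zero_right]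
    rw [dirDeriv_liftBase_sq_mul hw hVW]
    simp only [PseudoRiemannianMetric.pair, hl,
      mlieBracket_liftFiber_liftFiber (IB := IB) (hV x.2) (hW x.2),
      mlieBracket_liftFiber_liftBase hA (hV x.2), mlieBracket_liftFiber_liftBase hA (hW x.2)]
    simp [hl, hg, PseudoRiemannianMetric.pair]
    ring
  · have hCd := hC.mdifferentiableAt (by simp)
    have hK := gF.two_mul_val_cov hVd hWd hCd
    have hg := congrFun ((bcwpMetric gB gF c w hc hw hc0 hw0).pair_grad_left (w ∘ Prod.fst)
      (liftFiber C)) x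
    rw [dirDeriv_liftFiber_comp_fst hw1, PseudoRiemannianMetric.pair] at hg
    have hv : ∀ D D' : Π q : F, TangentSpace IF q, (bcwpMetric gB gF c w hc hw hc0 hw0).val x
        (liftFiber D x) (liftFiber D' x) = w x.1 ^ 2 * gF.val x.2 (D x.2) (D' x.2) :=
      fun D D' ↦ bcwpMetric_val_liftFiber gB gF hc hw hc0 hw0 D' x _
    simp only [PseudoRiemannianMetric.koszul, bcwpMetric_pair_liftFiber_liftFiber]
    rw [dirDeriv_liftFiber_sq_mul hw hVW,
      dirDeriv_liftFiber_sq_mul hw (gF.mdifferentiableAt_pair hVd hCd),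
      dirDeriv_liftFiber_sq_mul hw (gF.mdifferentiableAt_pair hWd hCd)]
    simp only [PseudoRiemannianMetric.pair, hv,
      mlieBracket_liftFiber_liftFiber (IB := IB) (hV x.2) (hW x.2),
      mlieBracket_liftFiber_liftFiber (IB := IB) (hV x.2) hC,
      mlieBracket_liftFiber_liftFiber (IB := IB) (hW x.2) hC]
    simp only [PseudoRiemannianMetric.koszul, PseudoRiemannianMetric.pair] at hK
    simp [hv, hg]
    linear_combination w x.1 ^ 2 * hK

end BaseConformalWarpedProduct

/-! ### Curvature of a conformally changed metric. -/

section Conformal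

variable {E : Type*} [NormedAddCommGroup E] [NormedSpace ℝ E]
  {H : Type*} [TopologicalSpace H] {I : ModelWithCorners ℝ E H}
  {M : Type*} [TopologicalSpace M] [ChartedSpace H M]

theorem dirDeriv_smul_left (f h : M → ℝ) (X : Π x : M, TangentSpace I x) (x : M) :
    dirDeriv (f • X) h x = f x * dirDeriv X h x := by
  simp [dirDeriv]

variable [IsManifold I ∞ M] [FiniteDimensional ℝ E] (g : PseudoRiemannianMetric I M) {c : M → ℝ}
  {X Y Z : Π x : M, TangentSpace I x}

theorem IsSmoothVectorField.conformalCov (hc : ContMDiff I 𝓘(ℝ, ℝ) ∞ c) (hc0 : ∀ x, c x ≠ 0)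
    (hX : IsSmoothVectorField X) (hY : IsSmoothVectorField Y) :
    IsSmoothVectorField (g.conformalCov c X Y) :=
  (((hX.cov g hY).add (.smul ((hX.dirDeriv hc).div₀ hc hc0) hY)).add
    (.smul ((hY.dirDeriv hc).div₀ hc hc0) hX)).sub
    (.smul ((hX.pair g hY).div₀ hc hc0) (.grad g hc))

namespace PseudoRiemannianMetric

theorem conformalCov_apply (X Y : Π x : M, TangentSpace I x) (x : M) :
    g.conformalCov c X Y x = g.cov X Y x + (dirDeriv X c x / c x) • Y x +
      (dirDeriv Y c x / c x) • X x - (g.pair X Y x / c x) • g.grad c x := rfl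

/-- Leibniz expansion into scalar multiples of a few vectors, ready for antisymmetrization in `X`
and `Y`. The derivative of `c` along `conformalCov c Y Z` stays unexpanded, being part of the
Hessian of `c` for `c² g`. -/
theorem conformalCov_conformalCov (hc : ContMDiff I 𝓘(ℝ, ℝ) ∞ c) (hc0 : ∀ x, c x ≠ 0)
    (hX : IsSmoothVectorField X) (hY : IsSmoothVectorField Y) (hZ : IsSmoothVectorField Z)
    (x : M) :
    g.conformalCov c X (g.conformalCov c Y Z) x =
      g.cov X (g.cov Y Z) x
      + ((dirDeriv X (dirDeriv Y c) x / c x - dirDeriv Y c x * dirDeriv X c x / c x ^ 2) • Z x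
        + (dirDeriv Y c x / c x) • g.cov X Z x)
      + ((dirDeriv X (dirDeriv Z c) x / c x - dirDeriv Z c x * dirDeriv X c x / c x ^ 2) • Y x
        + (dirDeriv Z c x / c x) • g.cov X Y x)
      - (((g.pair (g.cov X Y) Z x + g.pair Y (g.cov X Z) x) / c x
          - g.pair Y Z x * dirDeriv X c x / c x ^ 2) • g.grad c x
        + (g.pair Y Z x / c x) • g.cov X (g.grad c) x)
      + (dirDeriv X c x / c x) • (g.cov Y Z x + (dirDeriv Y c x / c x) • Z x +
        (dirDeriv Z c x / c x) • Y x - (g.pair Y Z x / c x) • g.grad c x)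
      + (dirDeriv (g.conformalCov c Y Z) c x / c x) • X x
      - ((g.pair X (g.cov Y Z) x + dirDeriv Y c x / c x * g.pair X Z x
          + dirDeriv Z c x / c x * g.pair X Y x - g.pair Y Z x / c x * dirDeriv X c x) / c x) •
        g.grad c x := by
  have hXx := hX.mdifferentiableAt x
  have hYc := (hY.dirDeriv hc).div₀ hc hc0
  have hZc := (hZ.dirDeriv hc).div₀ hc hc0
  have hYZ := (hY.pair g hZ).div₀ hc hc0
  have hG : IsSmoothVectorField (g.grad c) := .grad g hc
  have s1 := hY.cov g hZ
  have s2 := IsSmoothVectorField.smul hYc hZ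
  have s3 := IsSmoothVectorField.smul hZc hY
  have s4 := IsSmoothVectorField.smul hYZ hG
  have e1 : g.cov X (g.conformalCov c Y Z) x =
      g.cov X (g.cov Y Z) x
      + ((dirDeriv X (dirDeriv Y c) x / c x - dirDeriv Y c x * dirDeriv X c x / c x ^ 2) • Z x
        + (dirDeriv Y c x / c x) • g.cov X Z x)
      + ((dirDeriv X (dirDeriv Z c) x / c x - dirDeriv Z c x * dirDeriv X c x / c x ^ 2) • Y x
        + (dirDeriv Z c x / c x) • g.cov X Y x)
      - (((g.pair (g.cov X Y) Z x + g.pair Y (g.cov X Z) x) / c x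
          - g.pair Y Z x * dirDeriv X c x / c x ^ 2) • g.grad c x
        + (g.pair Y Z x / c x) • g.cov X (g.grad c) x) := by
    rw [conformalCov,
      g.cov_sub_right hXx (((s1.add s2).add s3).mdifferentiableAt x) (s4.mdifferentiableAt x),
      g.cov_add_right hXx ((s1.add s2).mdifferentiableAt x) (s3.mdifferentiableAt x),
      g.cov_add_right hXx (s1.mdifferentiableAt x) (s2.mdifferentiableAt x),
      g.cov_smul_right ((hYc x).mdifferentiableAt (by simp)) hXx (hZ.mdifferentiableAt x),
      g.cov_smul_right ((hZc x).mdifferentiableAt (by simp)) hXx (hY.mdifferentiableAt x),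
      g.cov_smul_right ((hYZ x).mdifferentiableAt (by simp)) hXx (hG.mdifferentiableAt x),
      dirDeriv_div (hY.dirDeriv hc) hc hc0, dirDeriv_div (hZ.dirDeriv hc) hc hc0,
      dirDeriv_div (hY.pair g hZ) hc hc0,
      g.dirDeriv_pair hXx (hY.mdifferentiableAt x) (hZ.mdifferentiableAt x)]
    rfl
  have e2 : g.pair X (g.conformalCov c Y Z) x =
      g.pair X (g.cov Y Z) x + dirDeriv Y c x / c x * g.pair X Z x
          + dirDeriv Z c x / c x * g.pair X Y x - g.pair Y Z x / c x * dirDeriv X c x := by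
    rw [← g.pair_grad_right c X]
    simp [pair, conformalCov_apply]
  rw [conformalCov_apply, e1, e2, conformalCov_apply g Y Z]

/-- The curvature of the conformal metric `c² g`. -/
theorem conformalCov_curvature [I.Boundaryless] (hc : ContMDiff I 𝓘(ℝ, ℝ) ∞ c)
    (hc0 : ∀ x, c x ≠ 0) (hX : IsSmoothVectorField X) (hY : IsSmoothVectorField Y)
    (hZ : IsSmoothVectorField Z) (x : M) :
    g.conformalCov c X (g.conformalCov c Y Z) x - g.conformalCov c Y (g.conformalCov c X Z) x
      - g.conformalCov c (VectorField.mlieBracket I X Y) Z x =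
    g.curvature X Y Z x
      - ((dirDeriv Y (dirDeriv Z c) x - dirDeriv (g.conformalCov c Y Z) c x) / c x) • X x
      + ((dirDeriv X (dirDeriv Z c) x - dirDeriv (g.conformalCov c X Z) c x) / c x) • Y x
      + (2 * (dirDeriv X c x / c x ^ 2) * g.pair Y Z x) • g.grad c x
      - (2 * (dirDeriv Y c x / c x ^ 2) * g.pair X Z x) • g.grad c x
      + (g.pair X Z x / c x) • g.cov Y (g.grad c) x
      - (g.pair Y Z x / c x) • g.cov X (g.grad c) x := by
  have : CompleteSpace E := FiniteDimensional.complete ℝ E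
  have hbr := g.cov_sub_cov_swap (hX.mdifferentiableAt x) (hY.mdifferentiableAt x)
  -- Outside `∇_[X,Y] Z` every bracket is replaced by `∇_X Y - ∇_Y X`, or by a commutator when it
  -- acts on `c`; the identity can then be checked coefficient by coefficient.
  have hp : g.pair (VectorField.mlieBracket I X Y) Z x =
      g.pair (g.cov X Y) Z x - g.pair (g.cov Y X) Z x := by
    simp [pair, ← hbr]
  have h0 := hc0 x
  rw [g.conformalCov_conformalCov hc hc0 hX hY hZ, g.conformalCov_conformalCov hc hc0 hY hX hZ,
    g.conformalCov_apply (VectorField.mlieBracket I X Y), dirDeriv_mlieBracket hc hX hY, hp, ← hbr,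
    curvature, g.pair_comm Y X]
  match_scalars <;> field_simp <;> ring

end PseudoRiemannianMetric

end Conformal

/-! ### Curvature of the warped product on lifts. -/

section BaseConformalWarpedProduct

variable {EB : Type*} [NormedAddCommGroup EB] [NormedSpace ℝ EB]
  {HB : Type*} [TopologicalSpace HB] {IB : ModelWithCorners ℝ EB HB}
  {B : Type*} [TopologicalSpace B] [ChartedSpace HB B]
  {EF : Type*} [NormedAddCommGroup EF] [NormedSpace ℝ EF]
  {HF : Type*} [TopologicalSpace HF] {IF : ModelWithCorners ℝ EF HF}
  {F : Type*} [TopologicalSpace F] [ChartedSpace HF F]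

/-- The lift of a tangent vector of `B` to `B × F`, as a linear map. -/
def liftBaseHom (x : B × F) : TangentSpace IB x.1 →ₗ[ℝ] TangentSpace (IB.prod IF) x :=
  LinearMap.inl ℝ (TangentSpace IB x.1) (TangentSpace IF x.2)

/-- The lift of a tangent vector of `F` to `B × F`, as a linear map. -/
def liftFiberHom (x : B × F) : TangentSpace IF x.2 →ₗ[ℝ] TangentSpace (IB.prod IF) x :=
  LinearMap.inr ℝ (TangentSpace IB x.1) (TangentSpace IF x.2)

theorem liftBaseHom_apply (X : Π p : B, TangentSpace IB p) (x : B × F) :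
    liftBaseHom (IF := IF) x (X x.1) = liftBase X x := rfl

theorem liftFiberHom_apply (V : Π q : F, TangentSpace IF q) (x : B × F) :
    liftFiberHom (IB := IB) x (V x.2) = liftFiber V x := rfl

theorem dirDeriv_comp_fst_mul_comp_snd (S : Π x : B × F, TangentSpace (IB.prod IF) x) {f : B → ℝ}
    {h : F → ℝ} {x : B × F} (hf : MDifferentiableAt IB 𝓘(ℝ, ℝ) f x.1)
    (hh : MDifferentiableAt IF 𝓘(ℝ, ℝ) h x.2) :
    dirDeriv S ((f ∘ Prod.fst) * (h ∘ Prod.snd)) x =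
      f x.1 * dirDeriv S (h ∘ Prod.snd) x + h x.2 * dirDeriv S (f ∘ Prod.fst) x :=
  dirDeriv_mul (hf.comp x mdifferentiableAt_fst) (hh.comp x mdifferentiableAt_snd)

/-- `∇_S (f V) = S(f) V + f ∇_S V` for a function `f` on the base. -/
theorem cov_comp_fst_smul [IsManifold IB ∞ B] [IsManifold IF ∞ F]
    [FiniteDimensional ℝ EB] [FiniteDimensional ℝ EF]
    (g : PseudoRiemannianMetric (IB.prod IF) (B × F)) {f : B → ℝ}
    (hf : ContMDiff IB 𝓘(ℝ, ℝ) ∞ f) {S T : Π x : B × F, TangentSpace (IB.prod IF) x}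
    (hS : IsSmoothVectorField S) (hT : IsSmoothVectorField T) (x : B × F) :
    g.cov S ((f ∘ Prod.fst : B × F → ℝ) • T) x =
      dirDeriv S (f ∘ Prod.fst) x • T x + f x.1 • g.cov S T x :=
  g.cov_smul_right (((hf x.1).mdifferentiableAt (by simp)).comp x mdifferentiableAt_fst)
    (hS.mdifferentiableAt x) (hT.mdifferentiableAt x)

variable [IsManifold IB ∞ B] [IsManifold IF ∞ F]
  (gB : PseudoRiemannianMetric IB B) (gF : PseudoRiemannianMetric IF F)
  {c w : B → ℝ} (hc : ContMDiff IB 𝓘(ℝ, ℝ) ∞ c) (hw : ContMDiff IB 𝓘(ℝ, ℝ) ∞ w)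
  (hc0 : ∀ p, 0 < c p) (hw0 : ∀ p, 0 < w p)
  [FiniteDimensional ℝ EB] [FiniteDimensional ℝ EF] [IB.Boundaryless] [IF.Boundaryless]
  {X Y Z : Π p : B, TangentSpace IB p} {V W U : Π q : F, TangentSpace IF q}

/-- As `∇_X Y` is again a base lift, the Hessian of a function on the base is its Hessian for `c²
g_B`. -/
theorem bcwpMetric_hessian_comp_fst {f : B → ℝ} (hf : ContMDiff IB 𝓘(ℝ, ℝ) ∞ f)
    (hX : IsSmoothVectorField X) (hY : IsSmoothVectorField Y) (x : B × F) :
    (bcwpMetric gB gF c w hc hw hc0 hw0).hessian (f ∘ Prod.fst) (liftBase X) (liftBase Y) x =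
      dirDeriv X (dirDeriv Y f) x.1 - dirDeriv (gB.conformalCov c X Y) f x.1 := by
  have e : dirDeriv (liftBase (IF := IF) Y) (f ∘ Prod.fst) = dirDeriv Y f ∘ (Prod.fst : B × F → B) :=
    funext fun y ↦ dirDeriv_liftBase_comp_fst ((hf y.1).mdifferentiableAt (by simp)) Y
  rw [PseudoRiemannianMetric.hessian, e, bcwpMetric_cov_liftBase_liftBase gB gF hc hw hc0 hw0 hX hY,
    dirDeriv_liftBase_comp_fst ((hY.dirDeriv hf x.1).mdifferentiableAt (by simp)),
    dirDeriv_liftBase_comp_fst ((hf x.1).mdifferentiableAt (by simp))]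

/-- Base lifts are closed under `∇` and the bracket, so the whole computation takes place on the
base with `conformalCov`. -/
theorem bcwpMetric_curvature_liftBase_liftBase_liftBase
    (hX : IsSmoothVectorField X) (hY : IsSmoothVectorField Y) (hZ : IsSmoothVectorField Z)
    (x : B × F) :
    (bcwpMetric gB gF c w hc hw hc0 hw0).curvature (liftBase X) (liftBase Y) (liftBase Z) x =
      liftBaseHom x (gB.conformalCov c X (gB.conformalCov c Y Z) x.1
        - gB.conformalCov c Y (gB.conformalCov c X Z) x.1
        - gB.conformalCov c (VectorField.mlieBracket IB X Y) Z x.1) := by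
  have : CompleteSpace EB := FiniteDimensional.complete ℝ EB
  have : CompleteSpace EF := FiniteDimensional.complete ℝ EF
  have hne : ∀ p, c p ≠ 0 := fun p ↦ (hc0 p).ne'
  have hbr : VectorField.mlieBracket (IB.prod IF) (liftBase X) (liftBase Y) =
      (liftBase (VectorField.mlieBracket IB X Y) : Π x : B × F, TangentSpace (IB.prod IF) x) :=
    funext fun y ↦ mlieBracket_liftBase_liftBase (hX y.1) (hY y.1)
  rw [PseudoRiemannianMetric.curvature, hbr,
    bcwpMetric_cov_liftBase_liftBase gB gF hc hw hc0 hw0 hY hZ,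
    bcwpMetric_cov_liftBase_liftBase gB gF hc hw hc0 hw0 hX hZ,
    bcwpMetric_cov_liftBase_liftBase gB gF hc hw hc0 hw0 hX (hY.conformalCov gB hc hne hZ),
    bcwpMetric_cov_liftBase_liftBase gB gF hc hw hc0 hw0 hY (hX.conformalCov gB hc hne hZ),
    bcwpMetric_cov_liftBase_liftBase gB gF hc hw hc0 hw0 (hX.mlieBracket hY) hZ, map_sub, map_sub]
  rfl

/-- In `∇_X((Y(w)/w) V)` the quadratic term `-X(w) Y(w)/w²` of the quotient rule cancels against
`(Y(w)/w) ∇_X V`, leaving `X(Y(w))/w`; subtracting `∇_V ∇_X Y = ((∇_X Y)(w)/w) V` produces the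
Hessian. -/
theorem bcwpMetric_curvature_liftBase_liftFiber_liftBase
    (hX : IsSmoothVectorField X) (hV : IsSmoothVectorField V) (hY : IsSmoothVectorField Y)
    (x : B × F) :
    (bcwpMetric gB gF c w hc hw hc0 hw0).curvature (liftBase X) (liftFiber V) (liftBase Y) x =
      ((bcwpMetric gB gF c w hc hw hc0 hw0).hessian (w ∘ Prod.fst) (liftBase X) (liftBase Y) x
        / w x.1) • liftFiber V x := by
  have : CompleteSpace EB := FiniteDimensional.complete ℝ EB
  have : CompleteSpace EF := FiniteDimensional.complete ℝ EF
  have hcne : ∀ p, c p ≠ 0 := fun p ↦ (hc0 p).ne'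
  have hwne : ∀ p, w p ≠ 0 := fun p ↦ (hw0 p).ne'
  have hbr : VectorField.mlieBracket (IB.prod IF) (liftBase X) (liftFiber V) =
      (0 : Π x : B × F, TangentSpace (IB.prod IF) x) :=
    funext fun y ↦ mlieBracket_liftBase_liftFiber (hX y.1) (hV y.2)
  have hf : ContMDiff IB 𝓘(ℝ, ℝ) ∞ (dirDeriv Y w / w) := (hY.dirDeriv hw).div₀ hw hwne
  rw [bcwpMetric_hessian_comp_fst gB gF hc hw hc0 hw0 hw hX hY, PseudoRiemannianMetric.curvature,
    hbr, PseudoRiemannianMetric.cov_zero_left _ (hY.liftBase.mdifferentiableAt x),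
    bcwpMetric_cov_liftFiber_liftBase gB gF hc hw hc0 hw0 hY hV,
    bcwpMetric_cov_liftBase_liftBase gB gF hc hw hc0 hw0 hX hY,
    bcwpMetric_cov_liftFiber_liftBase gB gF hc hw hc0 hw0 (hX.conformalCov gB hc hcne hY) hV,
    cov_comp_fst_smul _ hf hX.liftBase hV.liftFiber,
    bcwpMetric_cov_liftBase_liftFiber gB gF hc hw hc0 hw0 hX hV,
    dirDeriv_liftBase_comp_fst ((hf x.1).mdifferentiableAt (by simp)),
    dirDeriv_div (hY.dirDeriv hw) hw hwne]
  have h0 := hwne x.1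
  simp only [Pi.smul_apply', Function.comp_apply, Pi.div_apply]
  match_scalars
  field_simp
  ring

/-- By the same cancellation `∇_X ∇_Y V = (X(Y(w))/w) V`, and the commutator in `X`, `Y` is
`([X,Y](w)/w) V = ∇_[X,Y] V`. -/
theorem bcwpMetric_curvature_liftBase_liftBase_liftFiber
    (hX : IsSmoothVectorField X) (hY : IsSmoothVectorField Y) (hV : IsSmoothVectorField V)
    (x : B × F) :
    (bcwpMetric gB gF c w hc hw hc0 hw0).curvature (liftBase X) (liftBase Y) (liftFiber V) x =
      0 := by
  have : CompleteSpace EB := FiniteDimensional.complete ℝ EB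
  have : CompleteSpace EF := FiniteDimensional.complete ℝ EF
  have hwne : ∀ p, w p ≠ 0 := fun p ↦ (hw0 p).ne'
  have hbr : VectorField.mlieBracket (IB.prod IF) (liftBase X) (liftBase Y) =
      (liftBase (VectorField.mlieBracket IB X Y) : Π x : B × F, TangentSpace (IB.prod IF) x) :=
    funext fun y ↦ mlieBracket_liftBase_liftBase (hX y.1) (hY y.1)
  have hfX : ContMDiff IB 𝓘(ℝ, ℝ) ∞ (dirDeriv X w / w) := (hX.dirDeriv hw).div₀ hw hwne
  have hfY : ContMDiff IB 𝓘(ℝ, ℝ) ∞ (dirDeriv Y w / w) := (hY.dirDeriv hw).div₀ hw hwne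
  rw [PseudoRiemannianMetric.curvature, hbr,
    bcwpMetric_cov_liftBase_liftFiber gB gF hc hw hc0 hw0 hX hV,
    bcwpMetric_cov_liftBase_liftFiber gB gF hc hw hc0 hw0 hY hV,
    bcwpMetric_cov_liftBase_liftFiber gB gF hc hw hc0 hw0 (hX.mlieBracket hY) hV,
    cov_comp_fst_smul _ hfX hY.liftBase hV.liftFiber,
    cov_comp_fst_smul _ hfY hX.liftBase hV.liftFiber,
    bcwpMetric_cov_liftBase_liftFiber gB gF hc hw hc0 hw0 hX hV,
    bcwpMetric_cov_liftBase_liftFiber gB gF hc hw hc0 hw0 hY hV,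
    dirDeriv_liftBase_comp_fst ((hfX x.1).mdifferentiableAt (by simp)),
    dirDeriv_liftBase_comp_fst ((hfY x.1).mdifferentiableAt (by simp)),
    dirDeriv_div (hX.dirDeriv hw) hw hwne, dirDeriv_div (hY.dirDeriv hw) hw hwne]
  have h0 := hwne x.1
  simp only [Pi.smul_apply', Function.comp_apply, Pi.div_apply, dirDeriv_mlieBracket hw hX hY]
  match_scalars
  field_simp
  ring

/-- The factor `X(w)/w` is constant along the fibre, so it multiplies `∇_V W - ∇_W V - [V,W]`, the
torsion. -/
theorem bcwpMetric_curvature_liftFiber_liftFiber_liftBase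
    (hV : IsSmoothVectorField V) (hW : IsSmoothVectorField W) (hX : IsSmoothVectorField X)
    (x : B × F) :
    (bcwpMetric gB gF c w hc hw hc0 hw0).curvature (liftFiber V) (liftFiber W) (liftBase X) x =
      0 := by
  have : CompleteSpace EB := FiniteDimensional.complete ℝ EB
  have : CompleteSpace EF := FiniteDimensional.complete ℝ EF
  have hwne : ∀ p, w p ≠ 0 := fun p ↦ (hw0 p).ne'
  have hbr : VectorField.mlieBracket (IB.prod IF) (liftFiber V) (liftFiber W) =
      (liftFiber (VectorField.mlieBracket IF V W) : Π x : B × F, TangentSpace (IB.prod IF) x) :=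
    funext fun y ↦ mlieBracket_liftFiber_liftFiber (hV y.2) (hW y.2)
  have hf : ContMDiff IB 𝓘(ℝ, ℝ) ∞ (dirDeriv X w / w) := (hX.dirDeriv hw).div₀ hw hwne
  have ht := (bcwpMetric gB gF c w hc hw hc0 hw0).cov_sub_cov_swap
    (hV.liftFiber.mdifferentiableAt x) (hW.liftFiber.mdifferentiableAt x)
  rw [hbr] at ht
  rw [PseudoRiemannianMetric.curvature, hbr,
    bcwpMetric_cov_liftFiber_liftBase gB gF hc hw hc0 hw0 hX hV,
    bcwpMetric_cov_liftFiber_liftBase gB gF hc hw hc0 hw0 hX hW,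
    bcwpMetric_cov_liftFiber_liftBase gB gF hc hw hc0 hw0 hX (hV.mlieBracket hW),
    cov_comp_fst_smul _ hf hV.liftFiber hW.liftFiber,
    cov_comp_fst_smul _ hf hW.liftFiber hV.liftFiber,
    dirDeriv_liftFiber_comp_fst ((hf x.1).mdifferentiableAt (by simp)),
    dirDeriv_liftFiber_comp_fst ((hf x.1).mdifferentiableAt (by simp)),
    Pi.smul_apply', ← ht, Function.comp_apply]
  module

/-- `∇_S (∇^F_V W - w g_F(V, W) ∇w)`, by the Leibniz rule. -/
theorem bcwpMetric_cov_cov_liftFiber_liftFiber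
    (hV : IsSmoothVectorField V) (hW : IsSmoothVectorField W)
    {S : Π x : B × F, TangentSpace (IB.prod IF) x} (hS : IsSmoothVectorField S) (x : B × F) :
    (bcwpMetric gB gF c w hc hw hc0 hw0).cov S
        ((bcwpMetric gB gF c w hc hw hc0 hw0).cov (liftFiber V) (liftFiber W)) x =
      (bcwpMetric gB gF c w hc hw hc0 hw0).cov S (liftFiber (gF.cov V W)) x
      - (dirDeriv S ((w ∘ Prod.fst) * (gF.pair V W ∘ Prod.snd)) x •
          (bcwpMetric gB gF c w hc hw hc0 hw0).grad (w ∘ Prod.fst) x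
        + (w x.1 * gF.pair V W x.2) • (bcwpMetric gB gF c w hc hw hc0 hw0).cov S
          ((bcwpMetric gB gF c w hc hw hc0 hw0).grad (w ∘ Prod.fst)) x) := by
  have hφ : ContMDiff (IB.prod IF) 𝓘(ℝ, ℝ) ∞
      ((w ∘ Prod.fst) * (gF.pair V W ∘ Prod.snd) : B × F → ℝ) :=
    (hw.comp contMDiff_fst).mul ((hV.pair gF hW).comp contMDiff_snd)
  have hG : IsSmoothVectorField ((bcwpMetric gB gF c w hc hw hc0 hw0).grad (w ∘ Prod.fst)) :=
    .grad _ (hw.comp contMDiff_fst)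
  have hC : IsSmoothVectorField (liftFiber (gF.cov V W) :
      Π x : B × F, TangentSpace (IB.prod IF) x) := (hV.cov gF hW).liftFiber
  rw [bcwpMetric_cov_liftFiber_liftFiber gB gF hc hw hc0 hw0 hV hW,
    PseudoRiemannianMetric.cov_sub_right _ (hS.mdifferentiableAt x) (hC.mdifferentiableAt x)
      ((IsSmoothVectorField.smul hφ hG).mdifferentiableAt x),
    PseudoRiemannianMetric.cov_smul_right _ ((hφ x).mdifferentiableAt (by simp))
      (hS.mdifferentiableAt x) (hG.mdifferentiableAt x)]
  rfl

/-- Apart from `∇_X ∇w` everything cancels: both orders yield `(X(w)/w) ∇^F_V W` and `-X(w) g_F(V,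
W) ∇w`. -/
theorem bcwpMetric_curvature_liftFiber_liftBase_liftFiber
    (hV : IsSmoothVectorField V) (hX : IsSmoothVectorField X) (hW : IsSmoothVectorField W)
    (x : B × F) :
    (bcwpMetric gB gF c w hc hw hc0 hw0).curvature (liftFiber V) (liftBase X) (liftFiber W) x =
      (w x.1 * gF.pair V W x.2) • (bcwpMetric gB gF c w hc hw hc0 hw0).cov (liftBase X)
          ((bcwpMetric gB gF c w hc hw hc0 hw0).grad (w ∘ Prod.fst)) x := by
  have : CompleteSpace EB := FiniteDimensional.complete ℝ EB
  have : CompleteSpace EF := FiniteDimensional.complete ℝ EF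
  have hwne : ∀ p, w p ≠ 0 := fun p ↦ (hw0 p).ne'
  have hbr : VectorField.mlieBracket (IB.prod IF) (liftFiber V) (liftBase X) =
      (0 : Π x : B × F, TangentSpace (IB.prod IF) x) :=
    funext fun y ↦ mlieBracket_liftFiber_liftBase (hX y.1) (hV y.2)
  have hf : ContMDiff IB 𝓘(ℝ, ℝ) ∞ (dirDeriv X w / w) := (hX.dirDeriv hw).div₀ hw hwne
  have hwd := (hw x.1).mdifferentiableAt (by simp)
  have hVW := gF.mdifferentiableAt_pair (hV.mdifferentiableAt x.2) (hW.mdifferentiableAt x.2)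
  rw [PseudoRiemannianMetric.curvature, hbr,
    PseudoRiemannianMetric.cov_zero_left _ (hW.liftFiber.mdifferentiableAt x),
    bcwpMetric_cov_cov_liftFiber_liftFiber gB gF hc hw hc0 hw0 hV hW hX.liftBase,
    bcwpMetric_cov_liftBase_liftFiber gB gF hc hw hc0 hw0 hX hW,
    bcwpMetric_cov_liftBase_liftFiber gB gF hc hw hc0 hw0 hX (hV.cov gF hW),
    cov_comp_fst_smul _ hf hV.liftFiber hW.liftFiber,
    bcwpMetric_cov_liftFiber_liftFiber gB gF hc hw hc0 hw0 hV hW,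
    dirDeriv_liftFiber_comp_fst ((hf x.1).mdifferentiableAt (by simp)),
    dirDeriv_comp_fst_mul_comp_snd _ hwd hVW, dirDeriv_liftBase_comp_fst hwd,
    dirDeriv_liftBase_comp_snd hVW]
  have h0 := hwne x.1
  simp only [Pi.smul_apply', Pi.sub_apply, Pi.mul_apply, Function.comp_apply, Pi.div_apply]
  match_scalars <;> field_simp <;> ring

/-- `∇w` is a base lift, so the mixed formula applies with `X = c⁻² ∇^B w`. -/
theorem bcwpMetric_cov_liftFiber_grad (hV : IsSmoothVectorField V) (x : B × F) :
    (bcwpMetric gB gF c w hc hw hc0 hw0).cov (liftFiber V)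
        ((bcwpMetric gB gF c w hc hw hc0 hw0).grad (w ∘ Prod.fst)) x =
      (gB.pair (gB.grad w) (gB.grad w) x.1 / c x.1 ^ 2 / w x.1) • liftFiber V x := by
  have hs : ContMDiff IB 𝓘(ℝ, ℝ) ∞ (1 / c ^ 2) :=
    contMDiff_const.div₀ (hc.pow 2) fun p ↦ pow_ne_zero 2 (hc0 p).ne'
  rw [bcwpMetric_grad_comp_fst gB gF hc hw hc0 hw0 hw,
    bcwpMetric_cov_liftFiber_liftBase gB gF hc hw hc0 hw0 (.smul hs (.grad gB hw)) hV,
    Pi.smul_apply', Function.comp_apply, Pi.div_apply, dirDeriv_smul_left,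
    PseudoRiemannianMetric.pair_grad_left]
  congr 2
  simp
  ring

theorem bcwpMetric_curvature_liftFiber_liftFiber_liftFiber
    (hV : IsSmoothVectorField V) (hW : IsSmoothVectorField W) (hU : IsSmoothVectorField U)
    (x : B × F) :
    (bcwpMetric gB gF c w hc hw hc0 hw0).curvature (liftFiber V) (liftFiber W) (liftFiber U) x =
      liftFiber (gF.curvature V W U) x
        + (gB.pair (gB.grad w) (gB.grad w) x.1 / c x.1 ^ 2) •
            (gF.pair V U x.2 • liftFiber W x - gF.pair W U x.2 • liftFiber V x) := by
  have : CompleteSpace EB := FiniteDimensional.complete ℝ EB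
  have : CompleteSpace EF := FiniteDimensional.complete ℝ EF
  have hbr : VectorField.mlieBracket (IB.prod IF) (liftFiber V) (liftFiber W) =
      (liftFiber (VectorField.mlieBracket IF V W) : Π x : B × F, TangentSpace (IB.prod IF) x) :=
    funext fun y ↦ mlieBracket_liftFiber_liftFiber (hV y.2) (hW y.2)
  have hwd := (hw x.1).mdifferentiableAt (by simp)
  have hVd := hV.mdifferentiableAt x.2
  have hWd := hW.mdifferentiableAt x.2
  have hUd := hU.mdifferentiableAt x.2
  have hVU := gF.mdifferentiableAt_pair hVd hUd
  have hWU := gF.mdifferentiableAt_pair hWd hUd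
  -- With metric compatibility of `∇^F`, this makes the total coefficient of `∇w` vanish.
  have hp : gF.pair (VectorField.mlieBracket IF V W) U x.2 =
      gF.pair (gF.cov V W) U x.2 - gF.pair (gF.cov W V) U x.2 := by
    simp [PseudoRiemannianMetric.pair, ← gF.cov_sub_cov_swap hVd hWd]
  have hR : liftFiber (IB := IB) (gF.curvature V W U) x =
      liftFiber (gF.cov V (gF.cov W U)) x - liftFiber (gF.cov W (gF.cov V U)) x
        - liftFiber (gF.cov (VectorField.mlieBracket IF V W) U) x := by
    simp only [← liftFiberHom_apply, ← map_sub]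
    rfl
  rw [PseudoRiemannianMetric.curvature, hbr,
    bcwpMetric_cov_cov_liftFiber_liftFiber gB gF hc hw hc0 hw0 hW hU hV.liftFiber,
    bcwpMetric_cov_cov_liftFiber_liftFiber gB gF hc hw hc0 hw0 hV hU hW.liftFiber,
    bcwpMetric_cov_liftFiber_liftFiber gB gF hc hw hc0 hw0 (hV.mlieBracket hW) hU,
    bcwpMetric_cov_liftFiber_liftFiber gB gF hc hw hc0 hw0 hV (hW.cov gF hU),
    bcwpMetric_cov_liftFiber_liftFiber gB gF hc hw hc0 hw0 hW (hV.cov gF hU),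
    bcwpMetric_cov_liftFiber_grad gB gF hc hw hc0 hw0 hV,
    bcwpMetric_cov_liftFiber_grad gB gF hc hw hc0 hw0 hW,
    dirDeriv_comp_fst_mul_comp_snd _ hwd hVU, dirDeriv_comp_fst_mul_comp_snd _ hwd hWU,
    dirDeriv_liftFiber_comp_fst hwd, dirDeriv_liftFiber_comp_fst hwd,
    dirDeriv_liftFiber_comp_snd hVU, dirDeriv_liftFiber_comp_snd hWU,
    gF.dirDeriv_pair hVd hWd hUd, gF.dirDeriv_pair hWd hVd hUd, hR]
  have h0 := (hw0 x.1).ne'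
  have h1 := (hc0 x.1).ne'
  simp only [Pi.smul_apply', Pi.sub_apply, Pi.mul_apply, Function.comp_apply, hp]
  match_scalars <;> field_simp <;> ring

/-- `∇w = c⁻² ∇^B w` is differentiated by `conformalCov`: the leading term is the derivative of
`c⁻²`, the rest is `c⁻²` times `conformalCov c X (∇^B w)`. -/
theorem bcwpMetric_cov_liftBase_grad (hX : IsSmoothVectorField X) (x : B × F) :
    (bcwpMetric gB gF c w hc hw hc0 hw0).cov (liftBase X)
        ((bcwpMetric gB gF c w hc hw hc0 hw0).grad (w ∘ Prod.fst)) x =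
      (-2 * (dirDeriv X c x.1 / c x.1 ^ 3)) • liftBase (gB.grad w) x
        + (1 / c x.1 ^ 2) •
            (liftBase (gB.cov X (gB.grad w)) x
              + (dirDeriv X c x.1 / c x.1) • liftBase (gB.grad w) x
              + (gB.pair (gB.grad w) (gB.grad c) x.1 / c x.1) • liftBase X x
              - (dirDeriv X w x.1 / c x.1) • liftBase (gB.grad c) x) := by
  have hs : ContMDiff IB 𝓘(ℝ, ℝ) ∞ (1 / c ^ 2) :=
    contMDiff_const.div₀ (hc.pow 2) fun p ↦ pow_ne_zero 2 (hc0 p).ne'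
  have hG : IsSmoothVectorField (gB.grad w) := .grad gB hw
  have h0 := (hc0 x.1).ne'
  have hds : dirDeriv X (1 / c ^ 2) x.1 = -2 * (dirDeriv X c x.1 / c x.1 ^ 3) := by
    rw [dirDeriv_div (f := 1) (h := c ^ 2) contMDiff_const (hc.pow 2)
        fun p ↦ pow_ne_zero 2 (hc0 p).ne', dirDeriv_sq ((hc x.1).mdifferentiableAt (by simp))]
    have : dirDeriv X (1 : B → ℝ) x.1 = 0 := by
      have := mvfderiv_const (I := IB) (1 : ℝ) (x := x.1)
      exact congrArg (fun L ↦ L (X x.1)) this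
    rw [this]
    simp
    field_simp
  have hp : gB.pair X ((1 / c ^ 2) • gB.grad w) x.1 = 1 / c x.1 ^ 2 * dirDeriv X w x.1 := by
    rw [← gB.pair_grad_right w X]
    simp [PseudoRiemannianMetric.pair]
  rw [bcwpMetric_grad_comp_fst gB gF hc hw hc0 hw0 hw,
    bcwpMetric_cov_liftBase_liftBase gB gF hc hw hc0 hw0 hX (.smul hs hG)]
  simp only [← liftBaseHom_apply, ← map_smul, ← map_add, ← map_sub]
  congr 1
  rw [gB.conformalCov_apply, gB.cov_smul_right ((hs x.1).mdifferentiableAt (by simp))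
    (hX.mdifferentiableAt x.1) (hG.mdifferentiableAt x.1), hds, hp, dirDeriv_smul_left,
    ← gB.pair_grad_right c (gB.grad w), Pi.smul_apply', Pi.div_apply, Pi.one_apply, Pi.pow_apply]
  match_scalars <;> field_simp

end BaseConformalWarpedProduct

end

/-- The Riemann curvature of the base conformal warped product with metric
`g = c² g_B ⊕ w² g_F` on lifts of vector fields `X, Y, Z` on `B` and `V, W, U` on `F`. -/
theorem mainTheorem5
    {EB : Type*} [NormedAddCommGroup EB] [NormedSpace ℝ EB] [FiniteDimensional ℝ EB]
    {HB : Type*} [TopologicalSpace HB] {IB : ModelWithCorners ℝ EB HB} [IB.Boundaryless]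
    {B : Type*} [TopologicalSpace B] [ChartedSpace HB B] [IsManifold IB ∞ B]
    {EF : Type*} [NormedAddCommGroup EF] [NormedSpace ℝ EF] [FiniteDimensional ℝ EF]
    {HF : Type*} [TopologicalSpace HF] {IF : ModelWithCorners ℝ EF HF} [IF.Boundaryless]
    {F : Type*} [TopologicalSpace F] [ChartedSpace HF F] [IsManifold IF ∞ F]
    (gB : PseudoRiemannianMetric IB B) (gF : PseudoRiemannianMetric IF F)
    (c w : B → ℝ) (hc : ContMDiff IB 𝓘(ℝ, ℝ) ∞ c) (hw : ContMDiff IB 𝓘(ℝ, ℝ) ∞ w)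
    (hc0 : ∀ p, 0 < c p) (hw0 : ∀ p, 0 < w p)
    (X Y Z : Π p : B, TangentSpace IB p)
    (hX : IsSmoothVectorField X) (hY : IsSmoothVectorField Y) (hZ : IsSmoothVectorField Z)
    (V W U : Π q : F, TangentSpace IF q)
    (hV : IsSmoothVectorField V) (hW : IsSmoothVectorField W) (hU : IsSmoothVectorField U)
    (x : B × F) :
    let g : PseudoRiemannianMetric (IB.prod IF) (B × F) := bcwpMetric gB gF c w hc hw hc0 hw0
    let c' : B × F → ℝ := c ∘ Prod.fst
    let w' : B × F → ℝ := w ∘ Prod.fst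
    let X' : Π x : B × F, TangentSpace (IB.prod IF) x := liftBase X
    let Y' : Π x : B × F, TangentSpace (IB.prod IF) x := liftBase Y
    let Z' : Π x : B × F, TangentSpace (IB.prod IF) x := liftBase Z
    let V' : Π x : B × F, TangentSpace (IB.prod IF) x := liftFiber V
    let W' : Π x : B × F, TangentSpace (IB.prod IF) x := liftFiber W
    let U' : Π x : B × F, TangentSpace (IB.prod IF) x := liftFiber U
    let hessW : Π x : B × F, TangentSpace (IB.prod IF) x := g.cov X' (g.grad w')
    let p : B := x.1
    let q : F := x.2
    -- R(X, Y)Z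
    (g.curvature X' Y' Z' x =
      liftBase (gB.curvature X Y Z) x
        - (g.hessian c' Y' Z' x / c p) • X' x
        + (g.hessian c' X' Z' x / c p) • Y' x
        + (2 * (dirDeriv X c p / c p ^ 2) * gB.pair Y Z p) • liftBase (gB.grad c) x
        - (2 * (dirDeriv Y c p / c p ^ 2) * gB.pair X Z p) • liftBase (gB.grad c) x
        + (gB.pair X Z p / c p) • liftBase (gB.cov Y (gB.grad c)) x
        - (gB.pair Y Z p / c p) • liftBase (gB.cov X (gB.grad c)) x) ∧
    -- R(X, V)Y
    (g.curvature X' V' Y' x = (g.hessian w' X' Y' x / w p) • V' x) ∧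
    -- R(X, Y)V
    (g.curvature X' Y' V' x = 0) ∧
    -- R(V, W)X
    (g.curvature V' W' X' x = 0) ∧
    -- R(V, X)W
    (g.curvature V' X' W' x = (w p * gF.pair V W q) • hessW x) ∧
    -- R(V, W)U
    (g.curvature V' W' U' x =
      liftFiber (gF.curvature V W U) x
        + (gB.pair (gB.grad w) (gB.grad w) p / c p ^ 2) •
            (gF.pair V U q • W' x - gF.pair W U q • V' x)) ∧
    -- the field h^w(X) = ∇_X ∇w in terms of the base
    (hessW x =
      (-2 * (dirDeriv X c p / c p ^ 3)) • liftBase (gB.grad w) x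
        + (1 / c p ^ 2) •
            (liftBase (gB.cov X (gB.grad w)) x
              + (dirDeriv X c p / c p) • liftBase (gB.grad w) x
              + (gB.pair (gB.grad w) (gB.grad c) p / c p) • X' x
              - (dirDeriv X w p / c p) • liftBase (gB.grad c) x)) := by
  dsimp only
  have hcne : ∀ p, c p ≠ 0 := fun p ↦ (hc0 p).ne'
  refine ⟨?_, bcwpMetric_curvature_liftBase_liftFiber_liftBase gB gF hc hw hc0 hw0 hX hV hY x,
    bcwpMetric_curvature_liftBase_liftBase_liftFiber gB gF hc hw hc0 hw0 hX hY hV x,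
    bcwpMetric_curvature_liftFiber_liftFiber_liftBase gB gF hc hw hc0 hw0 hV hW hX x,
    bcwpMetric_curvature_liftFiber_liftBase_liftFiber gB gF hc hw hc0 hw0 hV hX hW x,
    bcwpMetric_curvature_liftFiber_liftFiber_liftFiber gB gF hc hw hc0 hw0 hV hW hU x,
    bcwpMetric_cov_liftBase_grad gB gF hc hw hc0 hw0 hX x⟩
  rw [bcwpMetric_curvature_liftBase_liftBase_liftBase gB gF hc hw hc0 hw0 hX hY hZ,
    gB.conformalCov_curvature hc hcne hX hY hZ,
    bcwpMetric_hessian_comp_fst gB gF hc hw hc0 hw0 hc hY hZ,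
    bcwpMetric_hessian_comp_fst gB gF hc hw hc0 hw0 hc hX hZ]
  -- Linearity of the lift gathers the right-hand side into the lift of one vector of the base.
  simp only [← liftBaseHom_apply, ← map_smul, ← map_add, ← map_sub]
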